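/- Write $\hat f(\xi)=\int_{\mathbb R}e^{-ix\xi}f(x)\,dx$ for the Fourier transform on $L^2(\mathbb R)=L^2(\mathbb R;\mathbb C)$, let $\Pi$ be the Szegő projector, $\widehat{\Pi f}=\mathbf 1_{[0,\infty)}\hat f$, and put $L^2_+=\Pi(L^2(\mathbb R))$, $H^1_+=H^1(\mathbb R)\cap L^2_+$, $\|f\|_{H^1}^2=\|f\|_{L^2}^2+\|\partial_xf\|_{L^2}^2$. Let $|D|^{1/2}$ be the Fourier multiplier with symbol $|\xi|^{1/2}$. For real numbers $m\ge 2$ and $\gamma\ge 0$ and $f\in H^1(\mathbb R)\setminus\{0\}$ set $$I_m^{(\gamma)}(f)=\frac{\|\partial_x f\|_{L^2}^m\|f\|_{L^2}^{m+2}+\gamma\,\||D|^{1/2}f\|_{L^2}^{2m}\|f\|_{L^2}^2}{\|f\|_{L^{2m+2}}^{2m+2}},\qquad J_m^{(\gamma)}=\inf_{f\in H^1_+\setminus\{0\}}I_m^{(\gamma)}(f),$$ and for $a,b>0$ let $$G_m^{(\gamma)}(a,b)=\{f\in H^1_+\setminus\{0\}:\ I_m^{(\gamma)}(f)=J_m^{(\gamma)},\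 \|f\|_{L^2}=a,\ \|f\|_{L^{2m+2}}=b\}.$$ **Theorem.** Let $m\ge 2$ and $\gamma\ge 0$. If $(f_n)_{n\in\mathbb N}$ is a sequence in $H^1_+$ with $\|f_n\|_{L^2}=\|f_n\|_{L^{2m+2}}=1$ for all $n$ and $\lim_{n\to\infty}I_m^{(\gamma)}(f_n)=J_m^{(\gamma)}$, then there exist $U\in G_m^{(\gamma)}(1,1)$, a strictly increasing $\psi:\mathbb N\to\mathbb N$ and a real sequence $(x_n)_{n\in\mathbb N}$ such that $$\lim_{n\to\infty}\|f_{\psi(n)}-U(\cdot-x_n)\|_{H^1}=0.$$ Moreover ground states exist: $G_m^{(\gamma)}(a,b)\neq\emptyset$ for all $a,b>0$. -/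

import Mathlib

open MeasureTheory Filter Topology FourierTransform
open scoped SchwartzMap LineDeriv ENNReal

namespace NLSSzego

noncomputable section

/-- The space `L²(ℝ)` of complex-valued functions. -/
abbrev L2 : Type := Lp ℂ 2 (volume : Measure ℝ)

/-- The Szegő projector on `L²(ℝ)`, which cancels all negative Fourier modes. -/
def szego (f : L2) : L2 :=
  𝓕⁻ (((Lp.memLp (𝓕 f : L2)).indicator (measurableSet_Ici (a := (0 : ℝ)))).toLp _)

/-- The Hardy space `L²₊ = Π(L²(ℝ))`. -/
def L2plus : Set L2 := Set.range szego

/-- The Sobolev space `H¹(ℝ)`. -/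
def H1 : Set L2 := {f | TemperedDistribution.MemSobolev 1 2 (f : 𝓢'(ℝ, ℂ))}

/-- The filtered Sobolev space `H¹₊ = H¹(ℝ) ∩ L²₊`. -/
def H1plus : Set L2 := H1 ∩ L2plus

open Classical in
/-- The weak derivative `∂ₓ f ∈ L²(ℝ)` of `f ∈ H¹(ℝ)`: the element of `L²(ℝ)` that represents the
distributional derivative of `f` (and `0` if there is none). -/
def dx (f : L2) : L2 :=
  if h : ∃ g : L2, (g : 𝓢'(ℝ, ℂ)) = ∂_{(1 : ℝ)} (f : 𝓢'(ℝ, ℂ)) then h.choose else 0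

/-- The symbol of `|D|^s`. As `𝓕 f ξ = ∫ e^{-2πi x ξ} f(x) dx`, the operator `D = -i∂ₓ` is the
Fourier multiplier with symbol `2πξ`. -/
def absDSymbol (s : ℝ) (ξ : ℝ) : ℝ := (2 * Real.pi * |ξ|) ^ s

open Classical in
/-- `|D|^s f ∈ L²(ℝ)`, the Fourier multiplier `|D|^s` applied to `f ∈ H^s(ℝ)` (and `0` if the
result is not in `L²(ℝ)`). -/
def absD (s : ℝ) (f : L2) : L2 :=
  if h : MemLp (fun ξ => absDSymbol s ξ • (𝓕 f : L2) ξ) 2 volume then 𝓕⁻ (h.toLp _) else 0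

/-- The `L^p` norm of `f`. -/
def lpNorm (p : ℝ) (f : L2) : ℝ := (eLpNorm f (ENNReal.ofReal p) volume).toReal

/-- The norm of `H¹(ℝ)`. -/
def h1Norm (f : L2) : ℝ := Real.sqrt (‖f‖ ^ 2 + ‖dx f‖ ^ 2)

/-- The translate `f(· - a)`. -/
def translate (a : ℝ) (f : L2) : L2 :=
  Lp.compMeasurePreserving (fun x => x - a) (measurePreserving_sub_right volume a) f

/-- The functional `I_m^{(γ)}`. -/
def I (m γ : ℝ) (f : L2) : ℝ :=
  (‖dx f‖ ^ m * ‖f‖ ^ (m + 2) + γ * ‖absD (1 / 2) f‖ ^ (2 * m) * ‖f‖ ^ 2) /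
    lpNorm (2 * m + 2) f ^ (2 * m + 2)

/-- The greatest lower bound `J_m^{(γ)}` of `I_m^{(γ)}` on `H¹₊ \ {0}`. -/
def J (m γ : ℝ) : ℝ := sInf (I m γ '' (H1plus \ {0}))

/-- The set `G_m^{(γ)}` of minimizers (ground states) of `I_m^{(γ)}` on `H¹₊ \ {0}`. -/
def G (m γ : ℝ) : Set L2 := {f | f ∈ H1plus \ {0} ∧ I m γ f = J m γ}

/-- The set `G_m^{(γ)}(a, b)` of ground states with `L²` norm `a` and `L^{2m+2}` norm `b`. -/
def GNorm (m γ a b : ℝ) : Set L2 := {f | f ∈ G m γ ∧ ‖f‖ = a ∧ lpNorm (2 * m + 2) f = b}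

/-! On `H¹` the default values of `dx` and `absD` are never used, and `J` is the infimum of a set
bounded below. -/

theorem mem_L2plus_iff (f : L2) :
    f ∈ L2plus ↔ ∀ᵐ ξ : ℝ, ξ < 0 → (𝓕 f : L2) ξ = 0 := by
  constructor
  · rintro ⟨g, rfl⟩
    unfold szego
    rw [fourier_fourierInv_eq]
    filter_upwards [((Lp.memLp (𝓕 g : L2)).indicator
      (measurableSet_Ici (a := (0 : ℝ)))).coeFn_toLp] with ξ hξ hneg
    rw [hξ, Set.indicator_of_notMem (by simpa using hneg)]
  · intro h
    refine ⟨f, ?_⟩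
    unfold szego
    have : ((Lp.memLp (𝓕 f : L2)).indicator (measurableSet_Ici (a := (0 : ℝ)))).toLp _
        = (𝓕 f : L2) := by
      apply Lp.ext
      filter_upwards [((Lp.memLp (𝓕 f : L2)).indicator
        (measurableSet_Ici (a := (0 : ℝ)))).coeFn_toLp, h] with ξ hξ h0
      rw [hξ]
      by_cases hx : ξ < 0
      · rw [h0 hx, Set.indicator_of_notMem (by simpa using hx)]
      · rw [Set.indicator_of_mem (by simpa using hx)]
    rw [this, fourierInv_fourier_eq]

theorem toTemperedDistribution_inj {f g : L2} (h : (f : 𝓢'(ℝ, ℂ)) = (g : 𝓢'(ℝ, ℂ))) : f = g := by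
  have hk := Lp.ker_toTemperedDistributionCLM_eq_bot (F := ℂ) (μ := (volume : Measure ℝ)) (p := 2)
  exact (LinearMap.ker_eq_bot.mp hk) h

theorem dx_spec {f : L2} (hf : f ∈ H1) :
    (dx f : 𝓢'(ℝ, ℂ)) = ∂_{(1 : ℝ)} (f : 𝓢'(ℝ, ℂ)) := by
  have h : ∃ g : L2, (g : 𝓢'(ℝ, ℂ)) = ∂_{(1 : ℝ)} (f : 𝓢'(ℝ, ℂ)) := by
    have h0 := TemperedDistribution.MemSobolev.lineDerivOp (m := (1 : ℝ)) hf
    rw [sub_self, TemperedDistribution.memSobolev_zero_iff] at h0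
    obtain ⟨g, hg⟩ := h0
    exact ⟨g, hg.symm⟩
  unfold dx
  rw [dif_pos h]
  exact h.choose_spec

theorem memLp_absD {s : ℝ} (hs0 : 0 ≤ s) (hs1 : s ≤ 1) {f : L2} (hf : f ∈ H1) :
    MemLp (fun ξ => absDSymbol s ξ • (𝓕 f : L2) ξ) 2 volume := by
  obtain ⟨u, hu⟩ := TemperedDistribution.memSobolev_iff_exists_smulLeftCLM_fourier.mp hf
  rw [Lp.fourier_toTemperedDistribution_eq] at hu
  have hw : Function.HasTemperateGrowth (fun x : ℝ => ((1 + ‖x‖ ^ 2) ^ (-(1 : ℝ) / 2) : ℝ)) := by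
    fun_prop
  have hbd : MemLp (fun x : ℝ => Complex.ofReal ((1 + ‖x‖ ^ 2) ^ (-(1 : ℝ) / 2) : ℝ)) ∞ volume := by
    have h : MemLp (fun x : ℝ => ((1 + ‖x‖ ^ 2) ^ (-(1 : ℝ) / 2) : ℝ)) ∞ volume := by
      refine memLp_top_of_bound hw.1.continuous.aestronglyMeasurable 1 ?_
      filter_upwards with x
      rw [Real.norm_of_nonneg (Real.rpow_nonneg (by positivity) _)]
      exact Real.rpow_le_one_of_one_le_of_nonpos (le_add_of_nonneg_right (by positivity))
        (by norm_num)
    exact h.ofReal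
  have key : (hbd.toLp _ • u : L2) = 𝓕 f := by
    apply toTemperedDistribution_inj
    rw [MeasureTheory.Lp.toTemperedDistribution_smul_eq (by fun_prop), ← hu,
      TemperedDistribution.smulLeftCLM_smulLeftCLM_apply (by fun_prop) (by fun_prop)]
    convert! TemperedDistribution.smulLeftCLM_const 1 ((𝓕 f : L2) : 𝓢'(ℝ, ℂ)) using 1
    · congr
      ext x
      rw [Pi.mul_apply, ← Complex.ofReal_mul, ← Real.rpow_add (by positivity),
        show (1 : ℝ) / 2 + -1 / 2 = 0 by norm_num, Real.rpow_zero, Complex.ofReal_one]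
    · simp
  have hmeas : Measurable (absDSymbol s) := by
    unfold absDSymbol
    fun_prop
  refine MemLp.of_le_mul (c := 2 * Real.pi) (Lp.memLp u)
    (hmeas.aestronglyMeasurable.smul (Lp.aestronglyMeasurable _)) ?_
  rw [← key]
  filter_upwards [Lp.coeFn_lpSMul (r := 2) (hbd.toLp _) u, hbd.coeFn_toLp] with ξ h1 h2
  rw [h1, Pi.smul_apply', h2, norm_smul, norm_smul, ← mul_assoc]
  refine mul_le_mul_of_nonneg_right ?_ (norm_nonneg _)
  have hpi : 1 ≤ 2 * Real.pi := by linarith [Real.pi_gt_three]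
  have h1s : absDSymbol s ξ ≤ 2 * Real.pi * (1 + ‖ξ‖ ^ 2) ^ ((1 : ℝ) / 2) := by
    unfold absDSymbol
    rw [Real.mul_rpow (by positivity) (by positivity)]
    have ha : (2 * Real.pi) ^ s ≤ 2 * Real.pi := by
      simpa using Real.rpow_le_rpow_of_exponent_le hpi hs1
    have hb : |ξ| ^ s ≤ (1 + ‖ξ‖ ^ 2) ^ ((1 : ℝ) / 2) := by
      have h3 : |ξ| ≤ (1 + ‖ξ‖ ^ 2) ^ ((1 : ℝ) / 2) := by
        rw [← Real.sqrt_eq_rpow]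
        apply Real.le_sqrt_of_sq_le
        rw [Real.norm_eq_abs]
        linarith
      have h4 : 1 ≤ (1 + ‖ξ‖ ^ 2) ^ ((1 : ℝ) / 2) :=
        Real.one_le_rpow (le_add_of_nonneg_right (by positivity)) (by norm_num)
      calc |ξ| ^ s ≤ ((1 + ‖ξ‖ ^ 2) ^ ((1 : ℝ) / 2)) ^ s :=
            Real.rpow_le_rpow (abs_nonneg _) h3 hs0
        _ ≤ ((1 + ‖ξ‖ ^ 2) ^ ((1 : ℝ) / 2)) ^ (1 : ℝ) :=
            Real.rpow_le_rpow_of_exponent_le h4 hs1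
        _ = _ := Real.rpow_one _
    exact mul_le_mul ha hb (by positivity) (by positivity)
  have h0s : 0 ≤ absDSymbol s ξ := by unfold absDSymbol; positivity
  rw [Real.norm_of_nonneg h0s, Complex.norm_real, Real.norm_of_nonneg (by positivity)]
  calc absDSymbol s ξ * (1 + ‖ξ‖ ^ 2) ^ (-(1 : ℝ) / 2)
      ≤ 2 * Real.pi * (1 + ‖ξ‖ ^ 2) ^ ((1 : ℝ) / 2) * (1 + ‖ξ‖ ^ 2) ^ (-(1 : ℝ) / 2) :=
        mul_le_mul_of_nonneg_right h1s (by positivity)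
    _ = 2 * Real.pi := by
        rw [mul_assoc, ← Real.rpow_add (by positivity)]
        norm_num

theorem bddBelow_I (m : ℝ) {γ : ℝ} (hγ : 0 ≤ γ) : BddBelow (I m γ '' (H1plus \ {0})) := by
  refine ⟨0, ?_⟩
  rintro _ ⟨f, -, rfl⟩
  unfold I lpNorm
  positivity

end

end NLSSzego

/-!
The proof is a concentration-compactness argument in which vanishing and dichotomy are excluded by
elementary means.

On the Fourier side `H¹(ℝ)` is parametrized by `h ∈ L²(ℝ)` through `Pop h = 𝓕⁻((1 + ξ²)^{-1/2} h)`;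
then `∂ₓ` and `|D|^{1/2}` become the bounded operators `Qop` and `Rop`, and the value of `Pop h` at
`x` is the continuous linear form `ev x` (`Pop_ae_eq`). A minimizing sequence `Pop (h n)` is bounded
in `H¹`. As its `L²` and `L^{2m+2}` norms are `1`, its supremum norm is at least `1`, so after a
translation `‖ev 0 (h n)‖ ≥ 1/2` (`exists_half_le_ev`). Hence a subsequence converges weakly to some
`h₀ ≠ 0`. Point evaluations are weakly continuous, so the functions also converge pointwise.

The squared norms of `Pop`, `Qop` and `Rop` split asymptotically between `h₀` and the remainder
(`tendsto_norm_sq_sub`), and so does the `p`-th power of the `L^p` norm, by a Brezis–Lieb argument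
(`tendsto_integral_rpow_sub`). Both parts satisfy `J * ‖·‖_p^p ≤ energy`. The energy
`A^{m/2} B^{(m+2)/2} + γ C^m B` is superadditive because `m ≥ 2`, with an additional gain
`A^{m/2} b^{(m+2)/2}` (`energy_add_le`), where `A > 0` belongs to `h₀` and `b` is the mass of the
remainder. Since nothing can be gained in the limit, `b = 0` (`no_splitting`): the convergence is
strong in `L²`, hence in `L^{2m+2}`, and then minimality forces strong convergence in `H¹`
(`no_loss`).

Ground states with prescribed norms come from the scaling `f ↦ c f(l ·)`, which leaves the functional
invariant (`exists_normalized`): it normalizes an arbitrary minimizing sequence, to which the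
compactness result applies, and it transports a ground state to the prescribed norms.
-/

namespace NLSSzego

noncomputable section

open scoped ComplexConjugate

/-! ### Multiplication operators on `L²(ℝ)` -/

/-- Multiplication by a bounded function, as a bounded operator on `L²(ℝ)`. -/
def mulOp {b : ℝ → ℂ} (hb : MemLp b ∞ (volume : Measure ℝ)) : L2 →L[ℂ] L2 :=
  (ContinuousLinearMap.mul ℂ ℂ).holderL volume ∞ 2 2 (hb.toLp b)

theorem coeFn_mulOp {b : ℝ → ℂ} (hb : MemLp b ∞ (volume : Measure ℝ)) (h : L2) :
    mulOp hb h =ᵐ[volume] fun ξ => b ξ * h ξ := by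
  filter_upwards [(ContinuousLinearMap.mul ℂ ℂ).coeFn_holder (r := 2) (hb.toLp b) h,
    hb.coeFn_toLp] with ξ h1 h2
  refine h1.trans ?_
  simp [h2]

theorem norm_sq_eq_integral (f : L2) : ‖f‖ ^ 2 = ∫ x, ‖f x‖ ^ 2 := by
  have h := L2.inner_def (𝕜 := ℂ) f f
  rw [inner_self_eq_norm_sq_to_K] at h
  have h2 : ∫ x, inner ℂ (f x) (f x) = ((∫ x, ‖f x‖ ^ 2 : ℝ) : ℂ) := by
    rw [← integral_complex_ofReal]
    congr 1
    ext x
    rw [inner_self_eq_norm_sq_to_K]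
    push_cast
    rfl
  rw [h2] at h
  apply Complex.ofReal_injective
  rw [← h]
  simp

theorem norm_sq_mulOp {b : ℝ → ℂ} (hb : MemLp b ∞ (volume : Measure ℝ)) (h : L2) :
    ‖mulOp hb h‖ ^ 2 = ∫ ξ, ‖b ξ‖ ^ 2 * ‖h ξ‖ ^ 2 := by
  rw [norm_sq_eq_integral]
  refine integral_congr_ae ?_
  filter_upwards [coeFn_mulOp hb h] with ξ hξ
  rw [hξ, norm_mul, mul_pow]

theorem integrable_norm_sq (f : L2) : Integrable (fun x => ‖f x‖ ^ 2) :=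
  (memLp_two_iff_integrable_sq_norm (Lp.aestronglyMeasurable f)).mp (Lp.memLp f)

/-! ### The operators that parametrize `H¹(ℝ)` -/

/-- The weight `(1 + ξ²)^{-1/2}`. -/
def wt (ξ : ℝ) : ℝ := (√(1 + ξ ^ 2))⁻¹

theorem wt_pos (ξ : ℝ) : 0 < wt ξ := by unfold wt; positivity

theorem wt_sq (ξ : ℝ) : wt ξ ^ 2 = (1 + ξ ^ 2)⁻¹ := by
  unfold wt
  rw [inv_pow, Real.sq_sqrt (by positivity)]

theorem continuous_wt : Continuous wt := by
  unfold wt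
  exact (by fun_prop : Continuous fun ξ : ℝ => √(1 + ξ ^ 2)).inv₀ fun ξ => by positivity

theorem wt_le_one (ξ : ℝ) : wt ξ ≤ 1 := by
  have := wt_sq ξ
  have h2 : (1 + ξ ^ 2)⁻¹ ≤ 1 := inv_le_one_of_one_le₀ (by nlinarith [sq_nonneg ξ])
  nlinarith [wt_pos ξ]

theorem abs_mul_wt_le_one (ξ : ℝ) : |ξ| * wt ξ ≤ 1 := by
  have h1 : (|ξ| * wt ξ) ^ 2 ≤ 1 := by
    rw [mul_pow, wt_sq, sq_abs, ← div_eq_mul_inv]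
    exact div_le_one_of_le₀ (by linarith) (by positivity)
  nlinarith [mul_nonneg (abs_nonneg ξ) (wt_pos ξ).le]

/-- The symbol of the inclusion of `H¹(ℝ)` into `L²(ℝ)`. -/
def symP (ξ : ℝ) : ℂ := wt ξ

/-- The symbol of `∂ₓ`, in the parametrization of `H¹(ℝ)` by `L²(ℝ)`. -/
def symQ (ξ : ℝ) : ℂ := 2 * Real.pi * Complex.I * ξ * wt ξ

/-- The symbol of `|D|^{1/2}`, in the parametrization of `H¹(ℝ)` by `L²(ℝ)`. -/
def symR (ξ : ℝ) : ℂ := absDSymbol (1 / 2) ξ * wt ξ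

theorem norm_symP (ξ : ℝ) : ‖symP ξ‖ = wt ξ := by
  simp [symP, abs_of_pos (wt_pos ξ)]

theorem norm_symQ (ξ : ℝ) : ‖symQ ξ‖ = 2 * Real.pi * (|ξ| * wt ξ) := by
  simp [symQ, abs_of_pos (wt_pos ξ), abs_of_pos Real.pi_pos]
  ring

theorem absDSymbol_nonneg (s ξ : ℝ) : 0 ≤ absDSymbol s ξ := by unfold absDSymbol; positivity

theorem measurable_absDSymbol (s : ℝ) : Measurable (absDSymbol s) := by
  unfold absDSymbol
  fun_prop

theorem absDSymbol_half_sq (ξ : ℝ) : absDSymbol (1 / 2) ξ ^ 2 = 2 * Real.pi * |ξ| := by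
  unfold absDSymbol
  rw [← Real.sqrt_eq_rpow, Real.sq_sqrt (by positivity)]

theorem norm_symR (ξ : ℝ) : ‖symR ξ‖ = absDSymbol (1 / 2) ξ * wt ξ := by
  simp only [symR, norm_mul, Complex.norm_real, Real.norm_eq_abs, abs_of_pos (wt_pos ξ),
    abs_of_nonneg (absDSymbol_nonneg _ _)]

theorem memLp_symP : MemLp symP ∞ (volume : Measure ℝ) := by
  refine memLp_top_of_bound ?_ 1 (ae_of_all _ fun ξ => ?_)
  · exact (Complex.continuous_ofReal.comp continuous_wt).aestronglyMeasurable
  · rw [norm_symP]; exact wt_le_one ξ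

theorem memLp_symQ : MemLp symQ ∞ (volume : Measure ℝ) := by
  refine memLp_top_of_bound ?_ (2 * Real.pi) (ae_of_all _ fun ξ => ?_)
  · have := continuous_wt
    exact (by unfold symQ; fun_prop : Continuous symQ).aestronglyMeasurable
  · rw [norm_symQ]
    nlinarith [abs_mul_wt_le_one ξ, Real.pi_pos]

theorem memLp_symR : MemLp symR ∞ (volume : Measure ℝ) := by
  refine memLp_top_of_bound ?_ (2 * Real.pi) (ae_of_all _ fun ξ => ?_)
  · have := continuous_wt.measurable
    have := measurable_absDSymbol (1 / 2)
    exact (by unfold symR; fun_prop : Measurable symR).aestronglyMeasurable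
  · rw [norm_symR]
    have h1 : (absDSymbol (1 / 2) ξ * wt ξ) ^ 2 ≤ (2 * Real.pi) ^ 2 := by
      rw [mul_pow, absDSymbol_half_sq, pow_two (wt ξ)]
      have : 2 * Real.pi * |ξ| * (wt ξ * wt ξ) = 2 * Real.pi * ((|ξ| * wt ξ) * wt ξ) := by ring
      rw [this]
      have h3 : (|ξ| * wt ξ) * wt ξ ≤ 1 :=
        mul_le_one₀ (abs_mul_wt_le_one ξ) (wt_pos ξ).le (wt_le_one ξ)
      nlinarith [Real.pi_gt_three]
    exact le_of_sq_le_sq h1 (by positivity)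

/-- The inverse Fourier transform as a bounded operator on `L²(ℝ)`. -/
def fourierInvOp : L2 →L[ℂ] L2 :=
  (Lp.fourierTransformₗᵢ ℝ ℂ).symm.toLinearIsometry.toContinuousLinearMap

theorem norm_fourierInv (h : L2) : ‖(𝓕⁻ h : L2)‖ = ‖h‖ :=
  (Lp.fourierTransformₗᵢ ℝ ℂ).symm.norm_map h

/-- The isomorphism `h ↦ 𝓕⁻((1 + ξ²)^{-1/2} h)` of `L²(ℝ)` onto `H¹(ℝ)`, as a map into `L²(ℝ)`. -/
def Pop : L2 →L[ℂ] L2 := fourierInvOp ∘L mulOp memLp_symP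

/-- The derivative of `Pop h`, as a bounded operator in `h`. -/
def Qop : L2 →L[ℂ] L2 := fourierInvOp ∘L mulOp memLp_symQ

/-- `|D|^{1/2}` applied to `Pop h`, as a bounded operator in `h`. -/
def Rop : L2 →L[ℂ] L2 := fourierInvOp ∘L mulOp memLp_symR

theorem fourier_Pop (h : L2) : (𝓕 (Pop h) : L2) = mulOp memLp_symP h :=
  fourier_fourierInv_eq _

theorem fourier_Qop (h : L2) : (𝓕 (Qop h) : L2) = mulOp memLp_symQ h :=
  fourier_fourierInv_eq _

theorem norm_sq_Pop (h : L2) : ‖Pop h‖ ^ 2 = ∫ ξ, wt ξ ^ 2 * ‖h ξ‖ ^ 2 := by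
  have : ‖Pop h‖ = ‖mulOp memLp_symP h‖ := norm_fourierInv _
  rw [this, norm_sq_mulOp]
  simp_rw [norm_symP]

theorem norm_sq_Qop (h : L2) :
    ‖Qop h‖ ^ 2 = ∫ ξ, (2 * Real.pi * (|ξ| * wt ξ)) ^ 2 * ‖h ξ‖ ^ 2 := by
  have : ‖Qop h‖ = ‖mulOp memLp_symQ h‖ := norm_fourierInv _
  rw [this, norm_sq_mulOp]
  simp_rw [norm_symQ]

theorem norm_sq_Rop (h : L2) :
    ‖Rop h‖ ^ 2 = ∫ ξ, (absDSymbol (1 / 2) ξ * wt ξ) ^ 2 * ‖h ξ‖ ^ 2 := by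
  have : ‖Rop h‖ = ‖mulOp memLp_symR h‖ := norm_fourierInv _
  rw [this, norm_sq_mulOp]
  simp_rw [norm_symR]

theorem norm_sq_eq_add (h : L2) :
    ‖h‖ ^ 2 = ‖Pop h‖ ^ 2 + (4 * Real.pi ^ 2)⁻¹ * ‖Qop h‖ ^ 2 := by
  have hi {b : ℝ → ℂ} (hb : MemLp b ∞ (volume : Measure ℝ)) :
      Integrable fun ξ => ‖b ξ‖ ^ 2 * ‖h ξ‖ ^ 2 := by
    refine (integrable_norm_sq (mulOp hb h)).congr ?_
    filter_upwards [coeFn_mulOp hb h] with ξ hξ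
    rw [hξ, norm_mul, mul_pow]
  have h1 := hi memLp_symP
  have h2 := hi memLp_symQ
  simp_rw [norm_symP] at h1
  simp_rw [norm_symQ] at h2
  rw [norm_sq_Pop, norm_sq_Qop, ← integral_const_mul, ← integral_add h1 (h2.const_mul _),
    norm_sq_eq_integral]
  congr 1
  ext ξ
  simp only [mul_pow, wt_sq, sq_abs]
  have := Real.pi_pos
  field_simp
  ring

/-! ### Description of `H¹(ℝ)` and of `H¹₊` on the Fourier side -/

theorem hasTemperateGrowth_bessel :
    Function.HasTemperateGrowth
      (fun x : ℝ => (((1 + ‖x‖ ^ 2) ^ ((1 : ℝ) / 2) : ℝ) : ℂ)) := by fun_prop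

theorem Pop_mem_H1 (h : L2) : Pop h ∈ H1 := by
  refine TemperedDistribution.memSobolev_iff_exists_smulLeftCLM_fourier.mpr ⟨h, ?_⟩
  rw [Lp.fourier_toTemperedDistribution_eq, fourier_Pop]
  ext u
  rw [TemperedDistribution.smulLeftCLM_apply_apply, Lp.toTemperedDistribution_apply,
    Lp.toTemperedDistribution_apply]
  refine integral_congr_ae ?_
  filter_upwards [coeFn_mulOp memLp_symP h] with ξ hξ
  rw [hξ, SchwartzMap.smulLeftCLM_apply_apply hasTemperateGrowth_bessel]
  simp only [smul_eq_mul, symP, wt, Real.norm_eq_abs, sq_abs, ← Real.sqrt_eq_rpow]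
  have : ((√(1 + ξ ^ 2) : ℝ) : ℂ) ≠ 0 := by
    norm_cast
    positivity
  push_cast
  field_simp

theorem exists_Pop_eq {f : L2} (hf : f ∈ H1) : ∃ h : L2, f = Pop h := by
  have h1 := memLp_absD zero_le_one le_rfl hf
  have hm : MemLp (fun ξ => ((wt ξ : ℂ))⁻¹ * (𝓕 f : L2) ξ) 2 volume := by
    refine MemLp.of_le ((Lp.memLp (𝓕 f : L2)).norm.add h1.norm) ?_ (ae_of_all _ fun ξ => ?_)
    · refine AEStronglyMeasurable.mul ?_ (Lp.aestronglyMeasurable _)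
      exact (Complex.measurable_ofReal.comp continuous_wt.measurable).inv.aestronglyMeasurable
    · have h2 : (wt ξ)⁻¹ ≤ 1 + absDSymbol 1 ξ := by
        unfold wt absDSymbol
        rw [inv_inv, Real.rpow_one]
        refine Real.sqrt_le_iff.mpr ⟨by positivity, ?_⟩
        have h3 : |ξ| ≤ 2 * Real.pi * |ξ| := by nlinarith [abs_nonneg ξ, Real.pi_gt_three]
        nlinarith [sq_abs ξ, abs_nonneg ξ]
      rw [norm_mul, norm_inv, Complex.norm_real, Real.norm_of_nonneg (wt_pos ξ).le]
      simp only [Pi.add_apply, norm_smul]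
      rw [Real.norm_of_nonneg (absDSymbol_nonneg 1 ξ), Real.norm_of_nonneg (by
        have := absDSymbol_nonneg 1 ξ
        positivity)]
      nlinarith [norm_nonneg ((𝓕 f : L2) ξ)]
  refine ⟨hm.toLp _, ?_⟩
  have : mulOp memLp_symP (hm.toLp _) = (𝓕 f : L2) := by
    apply Lp.ext
    filter_upwards [coeFn_mulOp memLp_symP (hm.toLp _), hm.coeFn_toLp] with ξ h1 h2
    rw [h1, h2, symP, mul_inv_cancel_left₀]
    exact_mod_cast (wt_pos ξ).ne'
  change f = 𝓕⁻ (mulOp memLp_symP (hm.toLp _))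
  rw [this, fourierInv_fourier_eq]

theorem Pop_mem_L2plus_iff (h : L2) : Pop h ∈ L2plus ↔ ∀ᵐ ξ : ℝ, ξ < 0 → h ξ = 0 := by
  rw [mem_L2plus_iff, fourier_Pop]
  refine eventually_congr ?_
  filter_upwards [coeFn_mulOp memLp_symP h] with ξ hξ
  have : symP ξ ≠ 0 := by
    rw [← norm_pos_iff, norm_symP]; exact wt_pos ξ
  simp [hξ, this]

theorem Pop_mem_H1plus_iff (h : L2) : Pop h ∈ H1plus ↔ ∀ᵐ ξ : ℝ, ξ < 0 → h ξ = 0 := by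
  rw [← Pop_mem_L2plus_iff]
  exact ⟨fun h => h.2, fun h' => ⟨Pop_mem_H1 h, h'⟩⟩

theorem dx_Pop (h : L2) : dx (Pop h) = Qop h := by
  apply toTemperedDistribution_inj
  rw [dx_spec (Pop_mem_H1 h)]
  have key : 𝓕 (∂_{(1 : ℝ)} (Pop h : 𝓢'(ℝ, ℂ))) = 𝓕 (Qop h : 𝓢'(ℝ, ℂ)) := by
    rw [TemperedDistribution.fourier_lineDerivOp_eq, Lp.fourier_toTemperedDistribution_eq,
      Lp.fourier_toTemperedDistribution_eq, fourier_Pop, fourier_Qop]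
    ext u
    have hi : (fun x : ℝ => ((inner ℝ x (1 : ℝ) : ℝ) : ℂ)).HasTemperateGrowth := by fun_prop
    change (2 * Real.pi * Complex.I) •
      (TemperedDistribution.smulLeftCLM ℂ (fun x : ℝ => ((inner ℝ x (1 : ℝ) : ℝ) : ℂ))
        (mulOp memLp_symP h : 𝓢'(ℝ, ℂ))) u = _
    rw [TemperedDistribution.smulLeftCLM_apply_apply, Lp.toTemperedDistribution_apply,
      Lp.toTemperedDistribution_apply, ← integral_smul]
    refine integral_congr_ae ?_
    filter_upwards [coeFn_mulOp memLp_symP h, coeFn_mulOp memLp_symQ h] with ξ h1 h2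
    rw [h1, h2, SchwartzMap.smulLeftCLM_apply_apply hi]
    simp [symP, symQ]
    ring
  have h2 := congrArg (fun T : 𝓢'(ℝ, ℂ) => 𝓕⁻ T) key
  simpa only [fourierInv_fourier_eq] using h2

theorem absD_half_Pop (h : L2) : absD (1 / 2) (Pop h) = Rop h := by
  have hm := memLp_absD (s := 1 / 2) (by norm_num) (by norm_num) (Pop_mem_H1 h)
  unfold absD
  rw [dif_pos hm]
  change _ = 𝓕⁻ (mulOp memLp_symR h)
  congr 1
  apply Lp.ext
  have h0 : (𝓕 (Pop h) : L2) =ᵐ[volume] fun ξ => symP ξ * h ξ := by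
    rw [fourier_Pop]; exact coeFn_mulOp memLp_symP h
  filter_upwards [hm.coeFn_toLp, coeFn_mulOp memLp_symR h, h0] with ξ h1 h2 h3
  rw [h1, h2, h3, symP, symR, Complex.real_smul]
  ring

/-! ### Point evaluation on `H¹(ℝ)` -/

/-- The character `ξ ↦ e^{2πi xξ}`. -/
def chi (x ξ : ℝ) : ℂ := Complex.exp ((2 * Real.pi * (ξ * x) : ℝ) * Complex.I)

theorem norm_chi (x ξ : ℝ) : ‖chi x ξ‖ = 1 := Complex.norm_exp_ofReal_mul_I _

theorem continuous_chi (x : ℝ) : Continuous (chi x) := by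
  unfold chi
  fun_prop

theorem chi_add (x y ξ : ℝ) : chi (x + y) ξ = chi x ξ * chi y ξ := by
  unfold chi
  rw [← Complex.exp_add]
  congr 1
  push_cast
  ring

theorem chi_zero (ξ : ℝ) : chi 0 ξ = 1 := by simp [chi]

theorem memLp_wt : MemLp wt 2 (volume : Measure ℝ) := by
  rw [memLp_two_iff_integrable_sq continuous_wt.aestronglyMeasurable]
  simp_rw [wt_sq]
  exact integrable_inv_one_add_sq

theorem memLp_evVec (x : ℝ) :
    MemLp (fun ξ => conj (chi x ξ) * (wt ξ : ℂ)) 2 (volume : Measure ℝ) := by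
  refine memLp_wt.of_le ?_ (ae_of_all _ fun ξ => ?_)
  · have := continuous_chi x
    have := continuous_wt
    exact (by fun_prop : Continuous fun ξ => conj (chi x ξ) * (wt ξ : ℂ)).aestronglyMeasurable
  · simp [norm_chi]

/-- The element of `L²(ℝ)` that represents the evaluation of `Pop h` at `x`. -/
def evVec (x : ℝ) : L2 := (memLp_evVec x).toLp _

/-- The value at `x` of the continuous representative of `Pop h`. -/
def ev (x : ℝ) (h : L2) : ℂ := inner ℂ (evVec x) h

theorem ev_eq_integral (x : ℝ) (h : L2) : ev x h = ∫ ξ, chi x ξ * (wt ξ * h ξ) := by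
  unfold ev
  rw [L2.inner_def]
  refine integral_congr_ae ?_
  filter_upwards [(memLp_evVec x).coeFn_toLp] with ξ hξ
  rw [evVec, hξ, RCLike.inner_apply]
  simp
  ring

theorem integrable_wt_mul (h : L2) : Integrable fun ξ => (wt ξ : ℂ) * h ξ :=
  MemLp.integrable_mul memLp_wt.ofReal (Lp.memLp h)

theorem ev_eq_fourierInv (x : ℝ) (h : L2) :
    ev x h = 𝓕⁻ (fun ξ => (wt ξ : ℂ) * h ξ) x := by
  rw [ev_eq_integral, Real.fourierInv_eq']
  simp [chi, mul_comm]

theorem ev_sub (x : ℝ) (h k : L2) : ev x (h - k) = ev x h - ev x k := inner_sub_right _ _ _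

theorem norm_evVec (x : ℝ) : ‖evVec x‖ = ‖evVec 0‖ := by
  have key (y : ℝ) : ‖evVec y‖ ^ 2 = ∫ ξ, wt ξ ^ 2 := by
    rw [norm_sq_eq_integral]
    refine integral_congr_ae ?_
    filter_upwards [(memLp_evVec y).coeFn_toLp] with ξ hξ
    rw [evVec, hξ]
    simp [norm_chi]
  have := (key x).trans (key 0).symm
  exact (sq_eq_sq₀ (norm_nonneg _) (norm_nonneg _)).mp this

theorem norm_ev_le (x : ℝ) (h : L2) : ‖ev x h‖ ≤ ‖evVec 0‖ * ‖h‖ := by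
  rw [← norm_evVec x]
  exact norm_inner_le_norm _ _

theorem continuous_ev (h : L2) : Continuous fun x => ev x h := by
  simp_rw [ev_eq_fourierInv]
  exact VectorFourier.fourierIntegral_continuous Real.continuous_fourierChar
    (by exact (continuous_inner (𝕜 := ℝ) (E := ℝ)).neg) (integrable_wt_mul h)

/-- `Pop h` and `ev · h` agree almost everywhere: against a test function `g` both sides are
`∫ 𝓕⁻g · (1 + ξ²)^{-1/2} h`, by Fubini for the right-hand side and by the definition of the Fourier
transform of distributions for the left-hand side. -/
theorem Pop_ae_eq (h : L2) : Pop h =ᵐ[volume] fun x => ev x h := by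
  refine ae_eq_of_integral_contDiff_smul_eq ((Lp.memLp _).locallyIntegrable (by norm_num))
    (continuous_ev h).locallyIntegrable fun g g_smooth g_cpt => ?_
  have hg₁ : HasCompactSupport (Complex.ofRealCLM ∘ g) := g_cpt.comp_left rfl
  have hg₂ : ContDiff ℝ ((⊤ : ℕ∞) : WithTop ℕ∞) (Complex.ofRealCLM ∘ g) := by fun_prop
  set u := hg₁.toSchwartzMap hg₂ with hu
  have h1 : ∫ x, g x • (Pop h) x = (Pop h : 𝓢'(ℝ, ℂ)) u := by
    simp [hu, Lp.toTemperedDistribution_apply]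
  have h2 : (Pop h : 𝓢'(ℝ, ℂ)) = 𝓕⁻ (mulOp memLp_symP h : 𝓢'(ℝ, ℂ)) :=
    (Lp.fourierInv_toTemperedDistribution_eq _).symm
  rw [h1, h2, TemperedDistribution.fourierInv_apply, Lp.toTemperedDistribution_apply,
    SchwartzMap.fourierInv_coe]
  have h3 := VectorFourier.integral_fourierIntegral_smul_eq_flip (μ := volume) (ν := volume)
    (e := Real.fourierChar) (L := -innerₗ ℝ) (f := (u : ℝ → ℂ))
    (g := fun ξ => (wt ξ : ℂ) * h ξ) Real.continuous_fourierChar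
    (by exact (continuous_inner (𝕜 := ℝ) (E := ℝ)).neg) u.integrable (integrable_wt_mul h)
  have hflip : (-innerₗ ℝ : ℝ →ₗ[ℝ] ℝ →ₗ[ℝ] ℝ).flip = -innerₗ ℝ := by
    ext
    simp
  rw [hflip] at h3
  have h4 : ∫ ξ, (𝓕⁻ (u : ℝ → ℂ)) ξ • (mulOp memLp_symP h) ξ
      = ∫ ξ, (𝓕⁻ (u : ℝ → ℂ)) ξ • ((wt ξ : ℂ) * h ξ) := by
    refine integral_congr_ae ?_
    filter_upwards [coeFn_mulOp memLp_symP h] with ξ hξ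
    rw [hξ, symP]
  rw [h4]
  refine Eq.trans h3 ?_
  congr 1
  ext x
  rw [ev_eq_fourierInv]
  rw [Complex.real_smul]
  rfl

/-! ### Translations -/

theorem memLp_chi (a : ℝ) : MemLp (chi a) ∞ (volume : Measure ℝ) :=
  memLp_top_of_bound (continuous_chi a).aestronglyMeasurable 1
    (ae_of_all _ fun ξ => (norm_chi a ξ).le)

/-- Translation by `-a`, in the parametrization of `H¹(ℝ)` by `L²(ℝ)`. -/
def Tr (a : ℝ) : L2 →L[ℂ] L2 := mulOp (memLp_chi a)

theorem coeFn_Tr (a : ℝ) (h : L2) : Tr a h =ᵐ[volume] fun ξ => chi a ξ * h ξ := coeFn_mulOp _ h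

theorem ev_Tr (x a : ℝ) (h : L2) : ev x (Tr a h) = ev (x + a) h := by
  rw [ev_eq_integral, ev_eq_integral]
  refine integral_congr_ae ?_
  filter_upwards [coeFn_Tr a h] with ξ hξ
  rw [hξ, chi_add]
  ring

theorem norm_Tr_ae (a : ℝ) (h : L2) : ∀ᵐ ξ, ‖Tr a h ξ‖ = ‖h ξ‖ := by
  filter_upwards [coeFn_Tr a h] with ξ hξ
  rw [hξ, norm_mul, norm_chi, one_mul]

theorem norm_Tr (a : ℝ) (h : L2) : ‖Tr a h‖ = ‖h‖ := by
  refine (sq_eq_sq₀ (norm_nonneg _) (norm_nonneg _)).mp ?_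
  rw [norm_sq_eq_integral, norm_sq_eq_integral]
  refine integral_congr_ae ?_
  filter_upwards [norm_Tr_ae a h] with ξ hξ
  rw [hξ]

theorem norm_Pop_Tr (a : ℝ) (h : L2) : ‖Pop (Tr a h)‖ = ‖Pop h‖ := by
  refine (sq_eq_sq₀ (norm_nonneg _) (norm_nonneg _)).mp ?_
  rw [norm_sq_Pop, norm_sq_Pop]
  refine integral_congr_ae ?_
  filter_upwards [norm_Tr_ae a h] with ξ hξ
  rw [hξ]

theorem norm_Qop_Tr (a : ℝ) (h : L2) : ‖Qop (Tr a h)‖ = ‖Qop h‖ := by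
  refine (sq_eq_sq₀ (norm_nonneg _) (norm_nonneg _)).mp ?_
  rw [norm_sq_Qop, norm_sq_Qop]
  refine integral_congr_ae ?_
  filter_upwards [norm_Tr_ae a h] with ξ hξ
  rw [hξ]

theorem norm_Rop_Tr (a : ℝ) (h : L2) : ‖Rop (Tr a h)‖ = ‖Rop h‖ := by
  refine (sq_eq_sq₀ (norm_nonneg _) (norm_nonneg _)).mp ?_
  rw [norm_sq_Rop, norm_sq_Rop]
  refine integral_congr_ae ?_
  filter_upwards [norm_Tr_ae a h] with ξ hξ
  rw [hξ]

theorem Tr_neg_Tr (a : ℝ) (h : L2) : Tr (-a) (Tr a h) = h := by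
  apply Lp.ext
  filter_upwards [coeFn_Tr (-a) (Tr a h), coeFn_Tr a h] with ξ h1 h2
  rw [h1, h2, ← mul_assoc, ← chi_add, neg_add_cancel, chi_zero, one_mul]

theorem Pop_Tr_neg (a : ℝ) (h : L2) : Pop (Tr (-a) h) = translate a (Pop h) := by
  apply Lp.ext
  have h1 := Lp.coeFn_compMeasurePreserving (Pop h) (measurePreserving_sub_right volume a)
  have h2 := (measurePreserving_sub_right volume a).quasiMeasurePreserving.ae (Pop_ae_eq h)
  filter_upwards [h1, h2, Pop_ae_eq (Tr (-a) h)] with x h1 h2 h3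
  rw [h3, translate, h1, Function.comp_apply, h2, ev_Tr, sub_eq_add_neg]

/-! ### Weak convergence in Hilbert spaces -/

section Hilbert

variable {E F : Type*} [NormedAddCommGroup E] [InnerProductSpace ℂ E] [CompleteSpace E]
  [NormedAddCommGroup F] [InnerProductSpace ℂ F] [CompleteSpace F]

/-- A bounded sequence in a separable Hilbert space has a weakly convergent subsequence. -/
theorem exists_weak_subseq [TopologicalSpace.SeparableSpace E] {h : ℕ → E} {K : ℝ}
    (hK : ∀ n, ‖h n‖ ≤ K) :
    ∃ (h₀ : E) (φ : ℕ → ℕ), StrictMono φ ∧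
      ∀ v : E, Tendsto (fun n => inner ℂ v (h (φ n))) atTop (𝓝 (inner ℂ v h₀)) := by
  have hc := WeakDual.isSeqCompact_closedBall ℂ E (0 : StrongDual ℂ E) K
  let T : ℕ → WeakDual ℂ E := fun n => StrongDual.toWeakDual (InnerProductSpace.toDual ℂ E (h n))
  have hT : ∀ n, T n ∈ WeakDual.toStrongDual ⁻¹' Metric.closedBall (0 : StrongDual ℂ E) K := by
    intro n
    rw [Set.mem_preimage, mem_closedBall_zero_iff]
    change ‖InnerProductSpace.toDual ℂ E (h n)‖ ≤ K
    rw [LinearIsometryEquiv.norm_map]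
    exact hK n
  obtain ⟨T₀, -, φ, hφ, hlim⟩ := hc hT
  refine ⟨(InnerProductSpace.toDual ℂ E).symm (WeakDual.toStrongDual T₀), φ, hφ, fun v => ?_⟩
  have h1 := ((WeakDual.eval_continuous v).tendsto T₀).comp hlim
  have h2 : Tendsto (fun n => inner ℂ (h (φ n)) v) atTop (𝓝 (T₀ v)) := h1
  have h3 := (Complex.continuous_conj.tendsto _).comp h2
  have h4 : inner ℂ ((InnerProductSpace.toDual ℂ E).symm (WeakDual.toStrongDual T₀)) v = T₀ v :=
    InnerProductSpace.toDual_symm_apply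
  rw [← inner_conj_symm, h4]
  refine h3.congr fun n => ?_
  simp only [Function.comp_apply, inner_conj_symm]

/-- A bounded operator maps a weakly convergent sequence to one along which the squared norm
splits. -/
theorem tendsto_norm_sq_sub (A : E →L[ℂ] F) {h : ℕ → E} {h₀ : E}
    (hw : ∀ v : E, Tendsto (fun n => inner ℂ v (h n)) atTop (𝓝 (inner ℂ v h₀))) :
    Tendsto (fun n => ‖A (h n)‖ ^ 2 - ‖A (h n - h₀)‖ ^ 2) atTop (𝓝 (‖A h₀‖ ^ 2)) := by
  have h1 := hw (A.adjoint (A h₀))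
  have h2 : Tendsto (fun n => 2 * (inner ℂ (A.adjoint (A h₀)) (h n)).re - ‖A h₀‖ ^ 2) atTop
      (𝓝 (2 * (inner ℂ (A.adjoint (A h₀)) h₀).re - ‖A h₀‖ ^ 2)) :=
    (((Complex.continuous_re.tendsto _).comp h1).const_mul 2).sub_const _
  have h3 : (inner ℂ (A.adjoint (A h₀)) h₀).re = ‖A h₀‖ ^ 2 := by
    rw [ContinuousLinearMap.adjoint_inner_left]
    exact inner_self_eq_norm_sq (𝕜 := ℂ) (A h₀)
  rw [h3] at h2
  convert h2 using 1
  · ext n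
    rw [ContinuousLinearMap.adjoint_inner_left, map_sub, @norm_sub_sq ℂ,
      ← inner_re_symm (𝕜 := ℂ) (A h₀)]
    simp only [RCLike.re_to_complex]
    ring
  · congr 1
    ring

end Hilbert

/-! ### The Brezis–Lieb splitting of the `L^p` norm -/

theorem rpow_sub_rpow_le {p s t : ℝ} (hp : 2 ≤ p) (hs : 0 ≤ s) (hst : s ≤ t) :
    t ^ p - s ^ p ≤ p * t ^ (p - 1) * (t - s) := by
  have hc : ConvexOn ℝ (Set.Ici 0) fun x : ℝ => x ^ p := convexOn_rpow (by linarith)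
  rcases hst.eq_or_lt with rfl | hlt
  · simp
  have ht : 0 < t := hs.trans_lt hlt
  have := hc.slope_le_of_hasDerivAt (x := s) (y := t) hs ht.le hlt
    (Real.hasDerivAt_rpow_const (Or.inl ht.ne'))
  rw [slope_def_field, div_le_iff₀ (by linarith)] at this
  exact this

theorem abs_rpow_norm_sub_le {p K : ℝ} (hp : 2 ≤ p) {a b : ℂ} (ha : ‖a‖ ≤ K) (hb : ‖b‖ ≤ K) :
    |‖a‖ ^ p - ‖b‖ ^ p| ≤ p * K ^ (p - 2) * (‖a - b‖ + ‖b‖) * ‖a - b‖ := by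
  have key (s t : ℝ) (hs : 0 ≤ s) (hst : s ≤ t) (ht : t ≤ K) :
      t ^ p - s ^ p ≤ p * K ^ (p - 2) * t * (t - s) := by
    refine (rpow_sub_rpow_le hp hs hst).trans ?_
    have h0 : 0 ≤ t := hs.trans hst
    have h1 : t ^ (p - 1) = t ^ (p - 2) * t := by
      rw [show p - 1 = (p - 2) + 1 by ring, Real.rpow_add_one' h0 (by linarith)]
    have h2 : t ^ (p - 2) ≤ K ^ (p - 2) := Real.rpow_le_rpow h0 ht (by linarith)
    rw [h1]
    have h3 : 0 ≤ t - s := by linarith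
    have h4 : t ^ (p - 2) * t ≤ K ^ (p - 2) * t := mul_le_mul_of_nonneg_right h2 h0
    calc p * (t ^ (p - 2) * t) * (t - s) ≤ p * (K ^ (p - 2) * t) * (t - s) := by gcongr
      _ = _ := by ring
  have hK : 0 ≤ K := (norm_nonneg _).trans ha
  have hC : 0 ≤ p * K ^ (p - 2) := by positivity
  have t1 : ‖a‖ ≤ ‖a - b‖ + ‖b‖ := by simpa using norm_add_le (a - b) b
  have t2 : ‖a‖ - ‖b‖ ≤ ‖a - b‖ := norm_sub_norm_le _ _
  have t3 : ‖b‖ - ‖a‖ ≤ ‖a - b‖ := by rw [norm_sub_rev]; exact norm_sub_norm_le _ _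
  rcases le_total ‖a‖ ‖b‖ with hab | hab
  · rw [abs_sub_comm, abs_of_nonneg (sub_nonneg.mpr (by gcongr))]
    refine (key _ _ (norm_nonneg _) hab hb).trans ?_
    have : ‖b‖ ≤ ‖a - b‖ + ‖b‖ := by linarith [norm_nonneg (a - b)]
    exact mul_le_mul (mul_le_mul_of_nonneg_left this hC) t3 (by linarith) (by positivity)
  · rw [abs_of_nonneg (sub_nonneg.mpr (by gcongr))]
    refine (key _ _ (norm_nonneg _) hab ha).trans ?_
    exact mul_le_mul (mul_le_mul_of_nonneg_left t1 hC) t2 (by linarith) (by positivity)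

theorem rpow_norm_le_mul_sq {p K : ℝ} (hp : 2 ≤ p) {a : ℂ} (ha : ‖a‖ ≤ K) :
    ‖a‖ ^ p ≤ K ^ (p - 2) * ‖a‖ ^ 2 := by
  have h1 : ‖a‖ ^ p = ‖a‖ ^ (p - 2) * ‖a‖ ^ 2 := by
    rw [← Real.rpow_natCast, ← Real.rpow_add' (norm_nonneg _) (by norm_num; linarith)]
    norm_num
  rw [h1]
  exact mul_le_mul_of_nonneg_right (Real.rpow_le_rpow (norm_nonneg _) ha (by linarith))
    (by positivity)

/-- If functions converge pointwise, are uniformly bounded and bounded in `L²`, the `L^p` norms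
split asymptotically. The integrand `‖g‖^p - ‖g - u‖^p - ‖u‖^p` is at most a constant times
`‖g - u‖ ‖u‖ + ‖u‖²`, hence at most `ε ‖g - u‖²` up to an integrable function that does not depend
on the index. -/
theorem tendsto_integral_rpow_sub {p K M : ℝ} (hp : 2 ≤ p) {g : ℕ → ℝ → ℂ} {u : ℝ → ℂ}
    (hg : ∀ n, Continuous (g n)) (hu : Continuous u)
    (hgK : ∀ n x, ‖g n x‖ ≤ K) (huK : ∀ x, ‖u x‖ ≤ K) (hguK : ∀ n x, ‖g n x - u x‖ ≤ K)
    (hu2 : Integrable fun x => ‖u x‖ ^ 2)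
    (hr2 : ∀ n, Integrable fun x => ‖g n x - u x‖ ^ 2)
    (hM : ∀ n, ∫ x, ‖g n x - u x‖ ^ 2 ≤ M)
    (hlim : ∀ x, Tendsto (fun n => g n x) atTop (𝓝 (u x))) :
    Tendsto (fun n => ∫ x, (‖g n x‖ ^ p - ‖g n x - u x‖ ^ p - ‖u x‖ ^ p)) atTop (𝓝 0) := by
  have hp0 : 0 ≤ p := by linarith
  have hK : 0 ≤ K := (norm_nonneg _).trans (huK 0)
  have hM0 : 0 ≤ M := le_trans (integral_nonneg fun x => by positivity) (hM 0)
  set C : ℝ := p * K ^ (p - 2) + 1 with hC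
  have hCpos : 0 < C := by positivity
  set D : ℕ → ℝ → ℝ := fun n x => ‖g n x‖ ^ p - ‖g n x - u x‖ ^ p - ‖u x‖ ^ p with hD
  have hDcont (n : ℕ) : Continuous (D n) := by
    have h1 := hg n
    refine Continuous.sub (Continuous.sub ?_ ?_) ?_ <;>
      exact Continuous.rpow_const (by fun_prop) fun x => Or.inr hp0
  have hKp : K ^ (p - 2) ≤ p * K ^ (p - 2) := by
    have : 0 ≤ K ^ (p - 2) := by positivity
    nlinarith
  -- pointwise bound of the integrand
  have hDle (n : ℕ) (x : ℝ) : |D n x| ≤ C * (‖g n x - u x‖ * ‖u x‖ + 2 * ‖u x‖ ^ 2) := by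
    have h1 := abs_rpow_norm_sub_le hp (hgK n x) (hguK n x)
    rw [sub_sub_cancel] at h1
    have h2 := rpow_norm_le_mul_sq hp (huK x)
    have h3 : |‖u x‖ ^ p| = ‖u x‖ ^ p := abs_of_nonneg (by positivity)
    have h4 : |D n x| ≤ |‖g n x‖ ^ p - ‖g n x - u x‖ ^ p| + |‖u x‖ ^ p| := abs_sub _ _
    have h5 : 0 ≤ ‖g n x - u x‖ * ‖u x‖ := by positivity
    nlinarith [sq_nonneg ‖u x‖]
  have hDzero (x : ℝ) : Tendsto (fun n => D n x) atTop (𝓝 0) := by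
    have h1 : Tendsto (fun n => ‖g n x‖ ^ p) atTop (𝓝 (‖u x‖ ^ p)) :=
      ((hlim x).norm).rpow_const (Or.inr hp0)
    have h2 : Tendsto (fun n => ‖g n x - u x‖ ^ p) atTop (𝓝 (‖u x - u x‖ ^ p)) :=
      (((hlim x).sub_const (u x)).norm).rpow_const (Or.inr hp0)
    have h3 := (h1.sub h2).sub_const (‖u x‖ ^ p)
    simpa [Real.zero_rpow (by linarith : p ≠ 0)] using h3
  rw [Metric.tendsto_atTop]
  intro ε hε
  -- weight of the part that is not dominated
  set δ : ℝ := ε / (2 * (C * (M + 1))) with hδ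
  have hδpos : 0 < δ := by positivity
  set W : ℕ → ℝ → ℝ := fun n x => max (|D n x| - C * δ * ‖g n x - u x‖ ^ 2) 0 with hW
  have hWcont (n : ℕ) : Continuous (W n) := by
    have h1 := hg n
    have h2 := hDcont n
    fun_prop
  have hWle (n : ℕ) (x : ℝ) : W n x ≤ C * (δ⁻¹ + 2) * ‖u x‖ ^ 2 := by
    refine max_le ?_ (by positivity)
    have h1 := hDle n x
    have h2 : ‖g n x - u x‖ * ‖u x‖ ≤ δ * ‖g n x - u x‖ ^ 2 + δ⁻¹ * ‖u x‖ ^ 2 := by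
      have h3 : 0 ≤ δ⁻¹ * (δ * ‖g n x - u x‖ - ‖u x‖) ^ 2 := by positivity
      have h4 : δ⁻¹ * (δ * ‖g n x - u x‖ - ‖u x‖) ^ 2 =
          δ * ‖g n x - u x‖ ^ 2 - 2 * (‖g n x - u x‖ * ‖u x‖) + δ⁻¹ * ‖u x‖ ^ 2 := by
        field_simp
        ring
      have h5 : 0 ≤ ‖g n x - u x‖ * ‖u x‖ := by positivity
      linarith
    have h6 : C * (‖g n x - u x‖ * ‖u x‖ + 2 * ‖u x‖ ^ 2) ≤
        C * (δ * ‖g n x - u x‖ ^ 2 + δ⁻¹ * ‖u x‖ ^ 2 + 2 * ‖u x‖ ^ 2) := by gcongr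
    linarith
  have hWnn (n : ℕ) (x : ℝ) : 0 ≤ W n x := le_max_right _ _
  have hWint (n : ℕ) : Integrable (W n) := by
    refine (hu2.const_mul (C * (δ⁻¹ + 2))).mono' (hWcont n).aestronglyMeasurable
      (ae_of_all _ fun x => ?_)
    rw [Real.norm_of_nonneg (hWnn n x)]
    exact hWle n x
  have hWlim : Tendsto (fun n => ∫ x, W n x) atTop (𝓝 (∫ _ : ℝ, (0 : ℝ))) := by
    refine tendsto_integral_of_dominated_convergence (fun x => C * (δ⁻¹ + 2) * ‖u x‖ ^ 2)
      (fun n => (hWcont n).aestronglyMeasurable) (hu2.const_mul _)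
      (fun n => ae_of_all _ fun x => ?_) (ae_of_all _ fun x => ?_)
    · rw [Real.norm_of_nonneg (hWnn n x)]
      exact hWle n x
    · refine squeeze_zero (fun n => hWnn n x) (fun n => ?_)
        (by simpa using (hDzero x).abs)
      exact max_le (by have : 0 ≤ C * δ * ‖g n x - u x‖ ^ 2 := by positivity
                       linarith) (abs_nonneg _)
  rw [integral_zero, Metric.tendsto_atTop] at hWlim
  obtain ⟨N, hN⟩ := hWlim (ε / 2) (by positivity)
  refine ⟨N, fun n hn => ?_⟩
  have h1 := hN n hn
  rw [Real.dist_0_eq_abs] at h1 ⊢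
  calc |∫ x, D n x| ≤ ∫ x, (W n x + C * δ * ‖g n x - u x‖ ^ 2) := by
        rw [← Real.norm_eq_abs]
        refine norm_integral_le_of_norm_le
          (g := fun x => W n x + C * δ * ‖g n x - u x‖ ^ 2) ((hWint n).add ((hr2 n).const_mul _))
          (ae_of_all _ fun x => ?_)
        rw [Real.norm_eq_abs]
        linarith [le_max_left (|D n x| - C * δ * ‖g n x - u x‖ ^ 2) 0]
    _ = (∫ x, W n x) + C * δ * ∫ x, ‖g n x - u x‖ ^ 2 := by
        rw [integral_add (hWint n) ((hr2 n).const_mul _), integral_const_mul]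
    _ ≤ |∫ x, W n x| + C * δ * M := by
        gcongr
        · exact le_abs_self _
        · exact hM n
    _ < ε := by
        have h2 : C * δ * M ≤ ε / 2 := by
          have h3 : C * δ * (M + 1) = ε / 2 := by
            rw [hδ]
            field_simp
          have h4 : 0 ≤ C * δ := by positivity
          nlinarith
        linarith

/-! ### The energy of a triple of squared norms -/

/-- The numerator of `I m γ`, in terms of the squares `A`, `B`, `C` of the `L²` norms of `∂ₓf`, `f`
and `|D|^{1/2} f`. -/
def energy (m γ A B C : ℝ) : ℝ := A ^ (m / 2) * B ^ ((m + 2) / 2) + γ * C ^ m * B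

theorem continuous_energy {m γ : ℝ} (hm : 2 ≤ m) :
    Continuous fun t : ℝ × ℝ × ℝ => energy m γ t.1 t.2.1 t.2.2 := by
  unfold energy
  have h1 : Continuous fun t : ℝ × ℝ × ℝ => t.1 ^ (m / 2) :=
    Continuous.rpow_const (by fun_prop) fun _ => Or.inr (by linarith)
  have h2 : Continuous fun t : ℝ × ℝ × ℝ => t.2.1 ^ ((m + 2) / 2) :=
    Continuous.rpow_const (by fun_prop) fun _ => Or.inr (by linarith)
  have h3 : Continuous fun t : ℝ × ℝ × ℝ => t.2.2 ^ m :=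
    Continuous.rpow_const (by fun_prop) fun _ => Or.inr (by linarith)
  fun_prop

/-- The energy is superadditive, and the gain contains the cross term `A ^ (m/2) * b ^ (m/2 + 1)`:
this is what excludes a splitting of the mass. -/
theorem energy_add_le {m γ A B C a b c : ℝ} (hm : 2 ≤ m) (hγ : 0 ≤ γ) (hA : 0 ≤ A) (hB : 0 ≤ B)
    (hC : 0 ≤ C) (ha : 0 ≤ a) (hb : 0 ≤ b) (hc : 0 ≤ c) :
    energy m γ A B C + energy m γ a b c + A ^ (m / 2) * b ^ ((m + 2) / 2) ≤
      energy m γ (A + a) (B + b) (C + c) := by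
  unfold energy
  have h1 := Real.add_rpow_le_rpow_add hA ha (by linarith : 1 ≤ m / 2)
  have h2 := Real.add_rpow_le_rpow_add hB hb (by linarith : 1 ≤ (m + 2) / 2)
  have h3 := Real.add_rpow_le_rpow_add hC hc (by linarith : 1 ≤ m)
  have h4 : (A ^ (m / 2) + a ^ (m / 2)) * (B ^ ((m + 2) / 2) + b ^ ((m + 2) / 2)) ≤
      (A + a) ^ (m / 2) * (B + b) ^ ((m + 2) / 2) := mul_le_mul h1 h2 (by positivity) (by positivity)
  have h5 : γ * (C ^ m + c ^ m) * (B + b) ≤ γ * (C + c) ^ m * (B + b) := by gcongr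
  have h6 : 0 ≤ a ^ (m / 2) * B ^ ((m + 2) / 2) := by positivity
  have h7 : 0 ≤ γ * C ^ m * b := by positivity
  have h8 : 0 ≤ γ * c ^ m * B := by positivity
  nlinarith

/-! ### The functional in the parametrization of `H¹(ℝ)` by `L²(ℝ)` -/

/-- `‖Pop h‖_{L^p}^p`. -/
def Lam (p : ℝ) (h : L2) : ℝ := ∫ x, ‖ev x h‖ ^ p

theorem Lam_nonneg (p : ℝ) (h : L2) : 0 ≤ Lam p h := integral_nonneg fun x => by positivity

theorem integrable_ev_sq (h : L2) : Integrable fun x => ‖ev x h‖ ^ 2 := by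
  refine (integrable_norm_sq (Pop h)).congr ?_
  filter_upwards [Pop_ae_eq h] with x hx
  rw [hx]

theorem integral_ev_sq (h : L2) : ∫ x, ‖ev x h‖ ^ 2 = ‖Pop h‖ ^ 2 := by
  rw [norm_sq_eq_integral]
  refine integral_congr_ae ?_
  filter_upwards [Pop_ae_eq h] with x hx
  rw [hx]

theorem continuous_ev_rpow {p : ℝ} (hp : 2 ≤ p) (h : L2) : Continuous fun x => ‖ev x h‖ ^ p :=
  Continuous.rpow_const (continuous_ev h).norm fun _ => Or.inr (by linarith)

theorem integrable_ev_rpow {p : ℝ} (hp : 2 ≤ p) (h : L2) :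
    Integrable fun x => ‖ev x h‖ ^ p := by
  refine ((integrable_ev_sq h).const_mul ((‖evVec 0‖ * ‖h‖) ^ (p - 2))).mono'
    (continuous_ev_rpow hp h).aestronglyMeasurable (ae_of_all _ fun x => ?_)
  rw [Real.norm_of_nonneg (by positivity)]
  exact rpow_norm_le_mul_sq hp (norm_ev_le x h)

theorem Lam_le {p K : ℝ} (hp : 2 ≤ p) {h : L2} (hK : ∀ x, ‖ev x h‖ ≤ K) :
    Lam p h ≤ K ^ (p - 2) * ‖Pop h‖ ^ 2 := by
  rw [← integral_ev_sq, ← integral_const_mul]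
  exact integral_mono (integrable_ev_rpow hp h) ((integrable_ev_sq h).const_mul _)
    fun x => rpow_norm_le_mul_sq hp (hK x)

theorem lpNorm_Pop {p : ℝ} (hp : 2 ≤ p) (h : L2) : lpNorm p (Pop h) = Lam p h ^ p⁻¹ := by
  have hp0 : ENNReal.ofReal p ≠ 0 := by simpa using (by linarith : 0 < p)
  have hpr : (ENNReal.ofReal p).toReal = p := ENNReal.toReal_ofReal (by linarith)
  have hmem : MemLp (fun x => ev x h) (ENNReal.ofReal p) volume := by
    rw [← integrable_norm_rpow_iff (continuous_ev h).aestronglyMeasurable hp0 ENNReal.ofReal_ne_top,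
      hpr]
    exact integrable_ev_rpow hp h
  unfold lpNorm
  rw [eLpNorm_congr_ae (Pop_ae_eq h), hmem.eLpNorm_eq_integral_rpow_norm hp0 ENNReal.ofReal_ne_top,
    hpr]
  exact ENNReal.toReal_ofReal (Real.rpow_nonneg (Lam_nonneg p h) _)

theorem lpNorm_Pop_rpow {p : ℝ} (hp : 2 ≤ p) (h : L2) : lpNorm p (Pop h) ^ p = Lam p h := by
  rw [lpNorm_Pop hp, Real.rpow_inv_rpow (Lam_nonneg p h) (by linarith)]

theorem Lam_Tr (p a : ℝ) (h : L2) : Lam p (Tr a h) = Lam p h := by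
  unfold Lam
  simp_rw [ev_Tr]
  exact integral_add_right_eq_self (fun x => ‖ev x h‖ ^ p) a

theorem Lam_smul (p : ℝ) (c : ℂ) (h : L2) : Lam p (c • h) = ‖c‖ ^ p * Lam p h := by
  unfold Lam
  rw [← integral_const_mul]
  congr 1
  ext x
  rw [ev, inner_smul_right, norm_mul, Real.mul_rpow (norm_nonneg _) (norm_nonneg _), ev]

theorem Lam_pos {p : ℝ} (hp : 2 ≤ p) {h : L2} (hh : Pop h ≠ 0) : 0 < Lam p h := by
  refine (Lam_nonneg p h).lt_of_ne fun h0 => hh ?_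
  have h1 := (integral_eq_zero_iff_of_nonneg (fun x => by positivity)
    (integrable_ev_rpow hp h)).mp h0.symm
  rw [Lp.eq_zero_iff_ae_eq_zero]
  filter_upwards [h1, Pop_ae_eq h] with x h2 h3
  rw [h3]
  have h4 : ‖ev x h‖ ^ p = 0 := h2
  simpa using ((Real.rpow_eq_zero_iff_of_nonneg (norm_nonneg _)).mp h4).1

/-- The numerator of `I m γ` at `Pop h`. -/
def En (m γ : ℝ) (h : L2) : ℝ := energy m γ (‖Qop h‖ ^ 2) (‖Pop h‖ ^ 2) (‖Rop h‖ ^ 2)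

theorem energy_nonneg {m γ A B C : ℝ} (hγ : 0 ≤ γ) (hA : 0 ≤ A) (hB : 0 ≤ B) (hC : 0 ≤ C) :
    0 ≤ energy m γ A B C := by
  unfold energy
  positivity

theorem En_nonneg {m γ : ℝ} (hγ : 0 ≤ γ) (h : L2) : 0 ≤ En m γ h :=
  energy_nonneg hγ (sq_nonneg _) (sq_nonneg _) (sq_nonneg _)

theorem sq_rpow_half {x : ℝ} (hx : 0 ≤ x) (s : ℝ) : (x ^ 2) ^ (s / 2) = x ^ s := by
  rw [← Real.rpow_natCast, ← Real.rpow_mul hx]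
  congr 1
  push_cast
  ring

theorem I_Pop {m : ℝ} (hm : 2 ≤ m) (γ : ℝ) (h : L2) :
    I m γ (Pop h) = En m γ h / Lam (2 * m + 2) h := by
  unfold I En energy
  rw [dx_Pop, absD_half_Pop, lpNorm_Pop_rpow (by linarith), sq_rpow_half (norm_nonneg _),
    sq_rpow_half (norm_nonneg _)]
  congr 4
  rw [← sq_rpow_half (norm_nonneg _)]
  congr 1
  ring

theorem J_mul_Lam_le {m γ : ℝ} (hm : 2 ≤ m) (hγ : 0 ≤ γ) {h : L2}
    (hs : ∀ᵐ ξ : ℝ, ξ < 0 → h ξ = 0) : J m γ * Lam (2 * m + 2) h ≤ En m γ h := by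
  by_cases h0 : Pop h = 0
  · have h1 : Lam (2 * m + 2) h = 0 := by
      have h2 := Lam_le (p := 2 * m + 2) (by linarith) (fun x => norm_ev_le x h)
      rw [h0] at h2
      refine le_antisymm ?_ (Lam_nonneg _ _)
      simpa using h2
    rw [h1, mul_zero]
    exact En_nonneg hγ h
  · rw [← le_div_iff₀ (Lam_pos (by linarith) h0), ← I_Pop hm]
    exact csInf_le (bddBelow_I m hγ) ⟨Pop h, ⟨(Pop_mem_H1plus_iff h).mpr hs, h0⟩, rfl⟩

theorem Qop_ne_zero {h : L2} (hh : h ≠ 0) : Qop h ≠ 0 := by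
  intro h0
  apply hh
  have h1 : mulOp memLp_symQ h = 0 := by
    rw [← fourier_Qop, h0]
    exact (Lp.fourierTransformₗᵢ ℝ ℂ).map_zero
  rw [Lp.eq_zero_iff_ae_eq_zero]
  have h2 := coeFn_mulOp memLp_symQ h
  rw [h1] at h2
  filter_upwards [h2, Lp.coeFn_zero ℂ 2 (volume : Measure ℝ), Measure.ae_ne volume (0 : ℝ)]
    with ξ h3 h4 h5
  have h6 : symQ ξ * h ξ = 0 := by rw [← h3, h4]; rfl
  refine (mul_eq_zero.mp h6).resolve_left (norm_pos_iff.mp ?_)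
  rw [norm_symQ]
  have := wt_pos ξ
  have := abs_pos.mpr h5
  positivity

/-- The condition that cuts out `L²₊` is closed under weak convergence. -/
theorem support_of_weak {h : ℕ → L2} {h₀ : L2} (hs : ∀ n, ∀ᵐ ξ : ℝ, ξ < 0 → h n ξ = 0)
    (hw : ∀ v : L2, Tendsto (fun n => inner ℂ v (h n)) atTop (𝓝 (inner ℂ v h₀))) :
    ∀ᵐ ξ : ℝ, ξ < 0 → h₀ ξ = 0 := by
  have hb : MemLp ((Set.Iio (0 : ℝ)).indicator fun _ => (1 : ℂ)) ∞ (volume : Measure ℝ) := by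
    refine memLp_top_of_bound (aestronglyMeasurable_const.indicator measurableSet_Iio) 1
      (ae_of_all _ fun ξ => ?_)
    exact (norm_indicator_le_norm_self _ _).trans (by simp)
  have h1 (n : ℕ) : mulOp hb (h n) = 0 := by
    rw [Lp.eq_zero_iff_ae_eq_zero]
    filter_upwards [hs n, coeFn_mulOp hb (h n)] with ξ h1 h2
    rw [h2]
    by_cases hξ : ξ < 0
    · simp [h1 hξ]
    · simp [Set.indicator_of_notMem (show ξ ∉ Set.Iio (0 : ℝ) from hξ)]
  have h2 := tendsto_norm_sq_sub (mulOp hb) hw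
  simp only [map_sub, h1, zero_sub, norm_neg, norm_zero] at h2
  have h3 := tendsto_nhds_unique h2 tendsto_const_nhds
  have h4 : mulOp hb h₀ = 0 := by
    rw [← norm_eq_zero]
    have : ‖mulOp hb h₀‖ ^ 2 = 0 := by linarith
    exact pow_eq_zero_iff (two_ne_zero) |>.mp this
  have h5 := coeFn_mulOp hb h₀
  rw [h4] at h5
  filter_upwards [h5, Lp.coeFn_zero ℂ 2 (volume : Measure ℝ)] with ξ h6 h7 hξ
  rw [h7] at h6
  simpa [Set.indicator_of_mem (show ξ ∈ Set.Iio (0 : ℝ) from hξ)] using h6.symm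

/-! ### Compactness of minimizing sequences -/

/-- A function with `‖Pop h‖_{L²} = ‖Pop h‖_{L^p} = 1` is at least `1/2` in modulus somewhere. -/
theorem exists_half_le_ev {p : ℝ} (hp : 2 < p) {h : L2} (h1 : ‖Pop h‖ = 1) (h2 : Lam p h = 1) :
    ∃ x, 1 / 2 ≤ ‖ev x h‖ := by
  by_contra! hc
  have h3 := Lam_le hp.le fun x => (hc x).le
  rw [h1, h2, one_pow, mul_one] at h3
  have h4 : (1 / 2 : ℝ) ^ (p - 2) < 1 :=
    Real.rpow_lt_one (by norm_num) (by norm_num) (by linarith)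
  linarith

theorem bounded_of_En_le {m γ E : ℝ} (hm : 2 ≤ m) (hγ : 0 ≤ γ) {h : L2} (h1 : ‖Pop h‖ = 1)
    (hE : En m γ h ≤ E) : ‖h‖ ≤ 1 + max 1 E := by
  have h2 : (‖Qop h‖ ^ 2) ^ (m / 2) ≤ E := by
    refine le_trans ?_ hE
    unfold En energy
    rw [h1, one_pow, Real.one_rpow, mul_one, mul_one]
    have : 0 ≤ γ * (‖Rop h‖ ^ 2) ^ m := by positivity
    linarith
  have h3 : ‖Qop h‖ ^ 2 ≤ max 1 E := by
    rcases le_total (‖Qop h‖ ^ 2) 1 with h4 | h4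
    · exact h4.trans (le_max_left _ _)
    · exact ((Real.self_le_rpow_of_one_le h4 (by linarith)).trans h2).trans (le_max_right _ _)
  have h4 := norm_sq_eq_add h
  have h5 : (4 * Real.pi ^ 2)⁻¹ ≤ 1 :=
    inv_le_one_of_one_le₀ (by nlinarith [Real.pi_gt_three])
  rw [h1] at h4
  have h6 : ‖h‖ ^ 2 ≤ 1 + max 1 E := by
    have := mul_le_mul_of_nonneg_right h5 (sq_nonneg ‖Qop h‖)
    linarith
  have h7 : 1 ≤ max 1 E := le_max_left _ _
  nlinarith [norm_nonneg h]

/-- The algebra behind the compactness theorem. In the limit a minimizing sequence splits into `U`,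
with squared norms `A`, `B`, `C` and `L^p` norm to the `p` equal to `L`, and a remainder with the
corresponding quantities `a`, `1 - B`, `c`, `1 - L`. Both parts satisfy the inequality that defines
`j`, so the cross term in the superadditivity of the energy vanishes. As `A > 0`, the remainder
carries no mass. -/
theorem no_splitting {m γ j A B C L a c : ℝ} (hm : 2 ≤ m) (hγ : 0 ≤ γ) (hA : 0 < A) (hB : 0 ≤ B)
    (hC : 0 ≤ C) (ha : 0 ≤ a) (hb : 0 ≤ 1 - B) (hc : 0 ≤ c)
    (hj : energy m γ (A + a) 1 (C + c) = j) (h1 : j * L ≤ energy m γ A B C)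
    (h2 : j * (1 - L) ≤ energy m γ a (1 - B) c) : B = 1 := by
  have h3 := energy_add_le hm hγ hA.le hB hC ha hb hc
  rw [add_sub_cancel, hj] at h3
  have h4 : A ^ (m / 2) * (1 - B) ^ ((m + 2) / 2) ≤ 0 := by linarith
  have h5 : 0 < A ^ (m / 2) := by positivity
  by_contra hne
  have h6 : 0 < 1 - B := hb.lt_of_ne fun h => hne (by linarith)
  have : 0 < (1 - B) ^ ((m + 2) / 2) := by positivity
  nlinarith

/-- Once the remainder carries no mass, minimality of the weak limit excludes a loss of the norm of
the derivative. -/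
theorem no_loss {m γ A C a c : ℝ} (hm : 2 ≤ m) (hγ : 0 ≤ γ) (hA : 0 ≤ A)
    (hC : 0 ≤ C) (ha : 0 ≤ a) (hc : 0 ≤ c)
    (h1 : energy m γ (A + a) 1 (C + c) ≤ energy m γ A 1 C) : a = 0 := by
  unfold energy at h1
  simp only [Real.one_rpow, mul_one] at h1
  have h2 := Real.add_rpow_le_rpow_add hA ha (by linarith : 1 ≤ m / 2)
  have h3 : γ * C ^ m ≤ γ * (C + c) ^ m := by gcongr; linarith
  by_contra hne
  have h4 : 0 < a := ha.lt_of_ne' hne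
  have : 0 < a ^ (m / 2) := by positivity
  linarith

/-- A normalized minimizing sequence converges in `H¹(ℝ)`, up to translations and along a subsequence,
to a minimizer. -/
theorem exists_limit_of_minimizing {m γ : ℝ} (hm : 2 ≤ m) (hγ : 0 ≤ γ) {h : ℕ → L2}
    (hs : ∀ n, ∀ᵐ ξ : ℝ, ξ < 0 → h n ξ = 0) (h1 : ∀ n, ‖Pop (h n)‖ = 1)
    (h2 : ∀ n, Lam (2 * m + 2) (h n) = 1)
    (hlim : Tendsto (fun n => En m γ (h n)) atTop (𝓝 (J m γ))) :
    ∃ h₀ : L2, (∀ᵐ ξ : ℝ, ξ < 0 → h₀ ξ = 0) ∧ ‖Pop h₀‖ = 1 ∧ Lam (2 * m + 2) h₀ = 1 ∧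
      En m γ h₀ = J m γ ∧ ∃ ψ : ℕ → ℕ, StrictMono ψ ∧ ∃ x : ℕ → ℝ,
        Tendsto (fun n => ‖Pop (Tr (x n) (h (ψ n)) - h₀)‖ ^ 2) atTop (𝓝 0) ∧
        Tendsto (fun n => ‖Qop (Tr (x n) (h (ψ n)) - h₀)‖ ^ 2) atTop (𝓝 0) := by
  have hp : 2 ≤ 2 * m + 2 := by linarith
  set p := 2 * m + 2 with hp_def
  obtain ⟨E, hE⟩ := hlim.bddAbove_range
  have hE' (n : ℕ) : En m γ (h n) ≤ E := hE ⟨n, rfl⟩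
  choose x hx using fun n => exists_half_le_ev (p := p) (by linarith) (h1 n) (h2 n)
  set K := 1 + max 1 E with hK
  have hhK (n : ℕ) : ‖Tr (x n) (h n)‖ ≤ K := by
    rw [norm_Tr]
    exact bounded_of_En_le hm hγ (h1 n) (hE' n)
  -- translations keep the sequence bounded and bring a point of modulus at least `1/2` to the origin
  have : Fact ((2 : ℝ≥0∞) ≠ ∞) := ⟨by simp⟩
  obtain ⟨h₀, φ₁, hφ₁, hw₁⟩ := exists_weak_subseq hhK
  -- a second extraction makes the norms of the remainder converge
  obtain ⟨⟨a, c⟩, -, φ₂, hφ₂, hac⟩ := tendsto_subseq_of_bounded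
    (s := Set.Icc (0 : ℝ × ℝ) ((‖Qop‖ * (K + ‖h₀‖)) ^ 2, (‖Rop‖ * (K + ‖h₀‖)) ^ 2))
    (Metric.isBounded_Icc _ _)
    (x := fun n => (‖Qop (Tr (x (φ₁ n)) (h (φ₁ n)) - h₀)‖ ^ 2,
      ‖Rop (Tr (x (φ₁ n)) (h (φ₁ n)) - h₀)‖ ^ 2)) (by
      intro n
      have hr : ‖Tr (x (φ₁ n)) (h (φ₁ n)) - h₀‖ ≤ K + ‖h₀‖ :=
        (norm_sub_le _ _).trans (by linarith [hhK (φ₁ n)])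
      have hop (T : L2 →L[ℂ] L2) :
          ‖T (Tr (x (φ₁ n)) (h (φ₁ n)) - h₀)‖ ^ 2 ≤ (‖T‖ * (K + ‖h₀‖)) ^ 2 := by
        gcongr
        exact T.le_opNorm_of_le hr
      exact ⟨⟨by positivity, by positivity⟩, ⟨hop _, hop _⟩⟩)
  set ψ : ℕ → ℕ := φ₁ ∘ φ₂ with hψ
  have hψm : StrictMono ψ := hφ₁.comp hφ₂
  set k : ℕ → L2 := fun n => Tr (x (ψ n)) (h (ψ n)) with hk
  have hw : ∀ v : L2, Tendsto (fun n => inner ℂ v (k n)) atTop (𝓝 (inner ℂ v h₀)) :=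
    fun v => (hw₁ v).comp hφ₂.tendsto_atTop
  have ha : Tendsto (fun n => ‖Qop (k n - h₀)‖ ^ 2) atTop (𝓝 a) :=
    ((continuous_fst.tendsto _).comp hac)
  have hc : Tendsto (fun n => ‖Rop (k n - h₀)‖ ^ 2) atTop (𝓝 c) :=
    ((continuous_snd.tendsto _).comp hac)
  have ha0 : 0 ≤ a := ge_of_tendsto' ha fun n => sq_nonneg _
  have hc0 : 0 ≤ c := ge_of_tendsto' hc fun n => sq_nonneg _
  have hkP (n : ℕ) : ‖Pop (k n)‖ = 1 := by rw [hk, norm_Pop_Tr, h1]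
  have hkL (n : ℕ) : Lam p (k n) = 1 := by rw [hk, Lam_Tr, h2]
  have hkK (n : ℕ) : ‖k n‖ ≤ K := hhK (ψ n)
  have hks (n : ℕ) : ∀ᵐ ξ : ℝ, ξ < 0 → k n ξ = 0 := by
    filter_upwards [hs (ψ n), coeFn_Tr (x (ψ n)) (h (ψ n))] with ξ h3 h4 hξ
    rw [hk, h4, h3 hξ, mul_zero]
  have hkE : Tendsto (fun n => En m γ (k n)) atTop (𝓝 (J m γ)) := by
    refine (hlim.comp hψm.tendsto_atTop).congr fun n => ?_
    simp only [Function.comp_apply, hk, En, norm_Pop_Tr, norm_Qop_Tr, norm_Rop_Tr]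
  have hs₀ := support_of_weak hks hw
  have hrs (n : ℕ) : ∀ᵐ ξ : ℝ, ξ < 0 → (k n - h₀ : L2) ξ = 0 := by
    filter_upwards [hks n, hs₀, Lp.coeFn_sub (k n) h₀] with ξ h3 h4 h5 hξ
    rw [h5, Pi.sub_apply, h3 hξ, h4 hξ, sub_zero]
  have hev (y : ℝ) : Tendsto (fun n => ev y (k n)) atTop (𝓝 (ev y h₀)) := hw _
  -- evaluation at the origin is weakly continuous, so the weak limit does not vanish
  have hne : h₀ ≠ 0 := by
    rintro rfl
    have h3 : 1 / 2 ≤ ‖ev 0 (0 : L2)‖ := by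
      refine ge_of_tendsto' (hev 0).norm fun n => ?_
      rw [hk, ev_Tr, zero_add]
      exact hx _
    rw [ev, inner_zero_right, norm_zero] at h3
    norm_num at h3
  have hA : 0 < ‖Qop h₀‖ ^ 2 := by
    have := norm_pos_iff.mpr (Qop_ne_zero hne)
    positivity
  -- asymptotic splitting of the norms
  have hP : Tendsto (fun n => ‖Pop (k n - h₀)‖ ^ 2) atTop (𝓝 (1 - ‖Pop h₀‖ ^ 2)) := by
    have h3 := (tendsto_norm_sq_sub Pop hw).const_sub 1
    refine h3.congr fun n => ?_
    rw [hkP]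
    ring
  have hQ : Tendsto (fun n => ‖Qop (k n)‖ ^ 2) atTop (𝓝 (‖Qop h₀‖ ^ 2 + a)) := by
    refine ((tendsto_norm_sq_sub Qop hw).add ha).congr fun n => ?_
    ring
  have hR : Tendsto (fun n => ‖Rop (k n)‖ ^ 2) atTop (𝓝 (‖Rop h₀‖ ^ 2 + c)) := by
    refine ((tendsto_norm_sq_sub Rop hw).add hc).congr fun n => ?_
    ring
  have hevK (n : ℕ) (y : ℝ) : ‖ev y (k n - h₀)‖ ≤ ‖evVec 0‖ * (K + ‖h₀‖) := by
    refine (norm_ev_le y _).trans ?_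
    gcongr
    exact (norm_sub_le _ _).trans (by linarith [hkK n])
  have hL : Tendsto (fun n => Lam p (k n - h₀)) atTop (𝓝 (1 - Lam p h₀)) := by
    have hK0 : 0 ≤ K := (norm_nonneg _).trans (hkK 0)
    have h3 := tendsto_integral_rpow_sub (p := p) (K := ‖evVec 0‖ * (K + ‖h₀‖))
      (M := (‖Pop‖ * (K + ‖h₀‖)) ^ 2) hp
      (g := fun n y => ev y (k n)) (u := fun y => ev y h₀) (fun n => continuous_ev _)
      (continuous_ev _)
      (fun n y => (norm_ev_le y _).trans (by gcongr; linarith [hkK n, norm_nonneg h₀]))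
      (fun y => (norm_ev_le y _).trans (by gcongr; linarith))
      (fun n y => by rw [← ev_sub]; exact hevK n y)
      (integrable_ev_sq h₀)
      (fun n => by simp_rw [← ev_sub]; exact integrable_ev_sq _)
      (fun n => by
        simp_rw [← ev_sub]
        rw [integral_ev_sq]
        gcongr
        exact Pop.le_opNorm_of_le ((norm_sub_le _ _).trans (by linarith [hkK n])))
      hev
    have h4 (n : ℕ) : ∫ y, (‖ev y (k n)‖ ^ p - ‖ev y (k n) - ev y h₀‖ ^ p - ‖ev y h₀‖ ^ p) =
        1 - Lam p (k n - h₀) - Lam p h₀ := by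
      simp_rw [← ev_sub]
      have h5 : Integrable fun y => ‖ev y (k n)‖ ^ p - ‖ev y (k n - h₀)‖ ^ p :=
        (integrable_ev_rpow hp _).sub (integrable_ev_rpow hp _)
      rw [integral_sub h5 (integrable_ev_rpow hp _),
        integral_sub (integrable_ev_rpow hp _) (integrable_ev_rpow hp _)]
      change Lam p (k n) - _ - _ = _
      rw [hkL]
      rfl
    simp_rw [h4] at h3
    have h5 := h3.const_sub (1 - Lam p h₀)
    rw [sub_zero] at h5
    refine h5.congr fun n => ?_
    ring
  have hb0 : 0 ≤ 1 - ‖Pop h₀‖ ^ 2 := ge_of_tendsto' hP fun n => sq_nonneg _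
  have hcont := continuous_energy (γ := γ) hm
  have hj : energy m γ (‖Qop h₀‖ ^ 2 + a) 1 (‖Rop h₀‖ ^ 2 + c) = J m γ := by
    refine tendsto_nhds_unique ?_ hkE
    have h3 : Tendsto (fun n => (‖Qop (k n)‖ ^ 2, ‖Pop (k n)‖ ^ 2, ‖Rop (k n)‖ ^ 2)) atTop
        (𝓝 (‖Qop h₀‖ ^ 2 + a, 1, ‖Rop h₀‖ ^ 2 + c)) := by
      refine hQ.prodMk_nhds (Tendsto.prodMk_nhds ?_ hR)
      simp_rw [hkP, one_pow]
      exact tendsto_const_nhds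
    exact (hcont.tendsto _).comp h3
  have hrem : J m γ * (1 - Lam p h₀) ≤ energy m γ a (1 - ‖Pop h₀‖ ^ 2) c := by
    have h3 := (hcont.tendsto _).comp (ha.prodMk_nhds (hP.prodMk_nhds hc))
    exact le_of_tendsto_of_tendsto' (hL.const_mul _) h3 fun n => J_mul_Lam_le hm hγ (hrs n)
  have hB := no_splitting hm hγ hA (sq_nonneg _) (sq_nonneg _) ha0 hb0 hc0 hj
    (J_mul_Lam_le hm hγ hs₀) hrem
  rw [hB, sub_self] at hP
  have hL1 : Lam p h₀ = 1 := by
    have h3 : Tendsto (fun n => Lam p (k n - h₀)) atTop (𝓝 0) := by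
      refine squeeze_zero (fun n => Lam_nonneg _ _) (fun n => Lam_le hp (hevK n)) ?_
      simpa using hP.const_mul ((‖evVec 0‖ * (K + ‖h₀‖)) ^ (p - 2))
    linarith [tendsto_nhds_unique hL h3]
  have hmin := J_mul_Lam_le hm hγ hs₀
  rw [← hp_def, hL1, mul_one] at hmin
  have ha' : a = 0 := by
    refine no_loss hm hγ hA.le (sq_nonneg _) ha0 hc0 (hj.trans_le (hmin.trans_eq ?_))
    rw [En, hB]
  refine ⟨h₀, hs₀, ?_, hL1, le_antisymm ?_ hmin, ψ, hψm, fun n => x (ψ n), hP, ha' ▸ ha⟩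
  · exact (pow_eq_one_iff_of_nonneg (norm_nonneg _) two_ne_zero).mp hB
  · rw [← hj, En, hB, ha', add_zero]
    unfold energy
    gcongr
    linarith

/-! ### Dilations and normalization -/

theorem quasiMeasurePreserving_mul_left {a : ℝ} (ha : a ≠ 0) :
    Measure.QuasiMeasurePreserving (fun x : ℝ => a * x) volume volume := by
  refine ⟨measurable_const_mul a, ?_⟩
  rw [Real.map_volume_mul_left ha]
  exact Measure.smul_absolutelyContinuous

theorem wt_inv_mul_le {l : ℝ} (hl : 0 < l) (ξ : ℝ) : wt (l⁻¹ * ξ) ≤ (1 + l) * wt ξ := by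
  refine le_of_sq_le_sq ?_ (mul_nonneg (by positivity) (wt_pos ξ).le)
  rw [mul_pow, wt_sq, wt_sq, ← div_eq_mul_inv, inv_le_comm₀ (by positivity) (by positivity),
    inv_div, div_le_iff₀ (by positivity)]
  have h1 : (1 + (l⁻¹ * ξ) ^ 2) * (1 + l) ^ 2 =
      1 + ξ ^ 2 + (2 * l + l ^ 2 + (l⁻¹ * ξ) ^ 2 * (1 + 2 * l)) := by
    field_simp
    ring
  rw [h1]
  have : 0 ≤ 2 * l + l ^ 2 + (l⁻¹ * ξ) ^ 2 * (1 + 2 * l) := by positivity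
  linarith

/-- The dilation `f ↦ f(l ·)`, in the parametrization of `H¹(ℝ)` by `L²(ℝ)`. -/
theorem exists_dilation {l : ℝ} (hl : 0 < l) {h : L2} (hs : ∀ᵐ ξ : ℝ, ξ < 0 → h ξ = 0) :
    ∃ k : L2, (∀ᵐ ξ : ℝ, ξ < 0 → k ξ = 0) ∧ (∀ x, ev x k = ev (l * x) h) ∧
      ‖Pop k‖ ^ 2 = l⁻¹ * ‖Pop h‖ ^ 2 ∧ ‖Qop k‖ ^ 2 = l * ‖Qop h‖ ^ 2 ∧
      ‖Rop k‖ ^ 2 = ‖Rop h‖ ^ 2 := by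
  have hl' : l⁻¹ ≠ 0 := by positivity
  have hq := quasiMeasurePreserving_mul_left hl'
  have hdil {E : Type} [NormedAddCommGroup E] [NormedSpace ℝ E] (G : ℝ → E) :
      ∫ ξ, G (l⁻¹ * ξ) = l • ∫ ξ, G ξ := by
    rw [Measure.integral_comp_mul_left, inv_inv, abs_of_pos hl]
  have hm : MemLp (fun ξ => (l⁻¹ * (wt (l⁻¹ * ξ) / wt ξ) : ℝ) • h (l⁻¹ * ξ)) 2 volume := by
    have hmeas : AEStronglyMeasurable (fun ξ => h (l⁻¹ * ξ)) volume :=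
      (Lp.aestronglyMeasurable h).comp_quasiMeasurePreserving hq
    have h1 : MemLp (fun ξ => h (l⁻¹ * ξ)) 2 volume :=
      (memLp_two_iff_integrable_sq_norm hmeas).mpr ((integrable_norm_sq h).comp_mul_left' hl')
    have hw : AEStronglyMeasurable (fun ξ => l⁻¹ * (wt (l⁻¹ * ξ) / wt ξ)) volume := by
      have := continuous_wt.measurable
      exact (by fun_prop : Measurable fun ξ => l⁻¹ * (wt (l⁻¹ * ξ) / wt ξ)).aestronglyMeasurable
    refine h1.of_le_mul (c := l⁻¹ * (1 + l)) (hw.smul hmeas) (ae_of_all _ fun ξ => ?_)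
    have h2 := wt_pos ξ
    have h3 := wt_pos (l⁻¹ * ξ)
    rw [norm_smul, Real.norm_of_nonneg (by positivity)]
    gcongr
    rw [div_le_iff₀ h2]
    exact wt_inv_mul_le hl ξ
  set k : L2 := hm.toLp _ with hk
  have hk1 : ∀ᵐ ξ, (wt ξ : ℂ) * k ξ = (l⁻¹ : ℝ) • ((wt (l⁻¹ * ξ) : ℂ) * h (l⁻¹ * ξ)) := by
    filter_upwards [hm.coeFn_toLp] with ξ hξ
    rw [hk, hξ]
    have h2 : (wt ξ : ℂ) ≠ 0 := by exact_mod_cast (wt_pos ξ).ne'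
    simp only [Complex.real_smul]
    push_cast
    field_simp
  have hk2 : ∀ᵐ ξ, wt ξ ^ 2 * ‖k ξ‖ ^ 2 =
      l⁻¹ ^ 2 * (wt (l⁻¹ * ξ) ^ 2 * ‖h (l⁻¹ * ξ)‖ ^ 2) := by
    filter_upwards [hk1] with ξ hξ
    have h2 := congrArg (fun z : ℂ => ‖z‖ ^ 2) hξ
    simp only [norm_smul, norm_mul, Complex.norm_real, Real.norm_eq_abs, mul_pow, sq_abs] at h2
    exact h2
  refine ⟨k, ?_, fun x => ?_, ?_, ?_, ?_⟩
  · filter_upwards [hm.coeFn_toLp, hq.ae hs] with ξ h1 h2 hξ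
    rw [hk, h1, h2 (mul_neg_of_pos_of_neg (by positivity) hξ), smul_zero]
  · rw [ev_eq_integral, ev_eq_integral]
    have h1 : ∫ ξ, chi x ξ * (wt ξ * k ξ) =
        l • ∫ η, (l⁻¹ : ℝ) • (chi (l * x) η * (wt η * h η)) := by
      rw [← hdil]
      refine integral_congr_ae ?_
      filter_upwards [hk1] with ξ hξ
      have h3 : chi (l * x) (l⁻¹ * ξ) = chi x ξ := by
        unfold chi
        congr 4
        field_simp
      rw [hξ, h3, mul_smul_comm]
    rw [h1, integral_smul, smul_smul, mul_inv_cancel₀ hl.ne', one_smul]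
  · rw [norm_sq_Pop, norm_sq_Pop]
    have h1 : ∫ ξ, wt ξ ^ 2 * ‖k ξ‖ ^ 2 =
        l • ∫ η, l⁻¹ ^ 2 * (wt η ^ 2 * ‖h η‖ ^ 2) := by
      rw [← hdil]
      exact integral_congr_ae hk2
    rw [h1, integral_const_mul, smul_eq_mul]
    field_simp
  · rw [norm_sq_Qop, norm_sq_Qop]
    have h1 : ∫ ξ, (2 * Real.pi * (|ξ| * wt ξ)) ^ 2 * ‖k ξ‖ ^ 2 =
        l • ∫ η, (2 * Real.pi * (|η| * wt η)) ^ 2 * ‖h η‖ ^ 2 := by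
      rw [← hdil]
      refine integral_congr_ae ?_
      filter_upwards [hk2] with ξ hξ
      have h3 : (2 * Real.pi * (|ξ| * wt ξ)) ^ 2 * ‖k ξ‖ ^ 2 =
        (2 * Real.pi * |ξ|) ^ 2 * (wt ξ ^ 2 * ‖k ξ‖ ^ 2) := by ring
      rw [h3, hξ, abs_mul, abs_of_pos (inv_pos.mpr hl)]
      ring
    rw [h1, smul_eq_mul]
  · rw [norm_sq_Rop, norm_sq_Rop]
    have h1 : ∫ ξ, (absDSymbol (1 / 2) ξ * wt ξ) ^ 2 * ‖k ξ‖ ^ 2 =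
        l • ∫ η, l⁻¹ * ((absDSymbol (1 / 2) η * wt η) ^ 2 * ‖h η‖ ^ 2) := by
      rw [← hdil]
      refine integral_congr_ae ?_
      filter_upwards [hk2] with ξ hξ
      simp only [mul_pow, absDSymbol_half_sq]
      rw [mul_assoc (2 * Real.pi * |ξ|), hξ, abs_mul, abs_of_pos (inv_pos.mpr hl)]
      ring
    rw [h1, integral_const_mul, smul_eq_mul]
    field_simp

theorem energy_scale {m : ℝ} (γ : ℝ) {s l A B C : ℝ} (hs : 0 < s) (hl : 0 < l)
    (hA : 0 ≤ A) (hB : 0 ≤ B) (hC : 0 ≤ C) :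
    energy m γ (s * (l * A)) (s * (l⁻¹ * B)) (s * C) = s ^ (m + 1) * l⁻¹ * energy m γ A B C := by
  unfold energy
  have h1 : s ^ (m / 2) * s ^ ((m + 2) / 2) = s ^ (m + 1) := by
    rw [← Real.rpow_add hs]
    congr 1
    ring
  have h2 : l ^ (m / 2) * l⁻¹ ^ ((m + 2) / 2) = l⁻¹ := by
    rw [Real.inv_rpow hl.le, ← Real.rpow_neg hl.le, ← Real.rpow_add hl, ← Real.rpow_neg_one]
    congr 1
    ring
  have h3 : s ^ m * s = s ^ (m + 1) := by rw [Real.rpow_add hs, Real.rpow_one]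
  rw [Real.mul_rpow hs.le (by positivity), Real.mul_rpow hl.le hA,
    Real.mul_rpow hs.le (by positivity), Real.mul_rpow (by positivity) hB, Real.mul_rpow hs.le hC]
  calc _ = (s ^ (m / 2) * s ^ ((m + 2) / 2)) * (l ^ (m / 2) * l⁻¹ ^ ((m + 2) / 2)) *
          (A ^ (m / 2) * B ^ ((m + 2) / 2)) + (s ^ m * s) * l⁻¹ * (γ * C ^ m * B) := by ring
    _ = _ := by rw [h1, h2, h3]; ring

/-- The two-parameter scaling `f ↦ c f(l ·)` leaves `I m γ` invariant and prescribes both norms. -/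
theorem exists_normalized {m γ a b : ℝ} (hm : 2 ≤ m) (ha : 0 < a) (hb : 0 < b) {h : L2}
    (hs : ∀ᵐ ξ : ℝ, ξ < 0 → h ξ = 0) (h0 : Pop h ≠ 0) :
    ∃ k : L2, (∀ᵐ ξ : ℝ, ξ < 0 → k ξ = 0) ∧ ‖Pop k‖ = a ∧ lpNorm (2 * m + 2) (Pop k) = b ∧
      I m γ (Pop k) = I m γ (Pop h) := by
  set p := 2 * m + 2 with hp
  have hp2 : 2 ≤ p := by linarith
  have hP : 0 < ‖Pop h‖ ^ 2 := by
    have := norm_pos_iff.mpr h0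
    positivity
  have hL := Lam_pos hp2 h0
  -- the solution of `c² l⁻¹ ‖Pop h‖² = a²`, `c^p l⁻¹ (Lam p h) = b^p`
  set t : ℝ := b ^ p * ‖Pop h‖ ^ 2 / (a ^ 2 * Lam p h) with ht
  have htpos : 0 < t := by positivity
  set c : ℝ := t ^ (p - 2)⁻¹ with hc
  have hcpos : 0 < c := by positivity
  have hct : c ^ (p - 2) = t := Real.rpow_inv_rpow htpos.le (by linarith)
  set l : ℝ := c ^ 2 * ‖Pop h‖ ^ 2 / a ^ 2 with hl
  have hlpos : 0 < l := by positivity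
  obtain ⟨k, hks, hkev, hkP, hkQ, hkR⟩ := exists_dilation hlpos hs
  have hn : ‖(c : ℂ)‖ = c := by simp [abs_of_pos hcpos]
  have hLk : Lam p k = l⁻¹ * Lam p h := by
    unfold Lam
    simp_rw [hkev]
    rw [Measure.integral_comp_mul_left (fun x => ‖ev x h‖ ^ p), abs_of_pos (by positivity),
      smul_eq_mul]
  have hLck : Lam p ((c : ℂ) • k) = c ^ p * l⁻¹ * Lam p h := by
    rw [Lam_smul, hn, hLk, mul_assoc]
  have hsm (T : L2 →L[ℂ] L2) : ‖T ((c : ℂ) • k)‖ ^ 2 = c ^ 2 * ‖T k‖ ^ 2 := by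
    rw [map_smul, norm_smul, hn, mul_pow]
  have hcp : c ^ p = c ^ (p - 2) * c ^ 2 := by
    rw [← Real.rpow_natCast, ← Real.rpow_add hcpos]
    norm_num
  refine ⟨(c : ℂ) • k, ?_, ?_, ?_, ?_⟩
  · filter_upwards [hks, Lp.coeFn_smul (c : ℂ) k] with ξ h1 h2 hξ
    rw [h2, Pi.smul_apply, h1 hξ, smul_zero]
  · refine (sq_eq_sq₀ (norm_nonneg _) ha.le).mp ?_
    rw [hsm, hkP, hl]
    field_simp
  · rw [lpNorm_Pop hp2, hLck]
    have h1 : c ^ p * l⁻¹ * Lam p h = b ^ p := by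
      rw [hcp, hct, hl, ht]
      field_simp
    rw [h1, Real.rpow_rpow_inv hb.le (by linarith)]
  · rw [I_Pop hm, I_Pop hm, ← hp, hLck, En, hsm, hsm, hsm, hkP, hkQ, hkR,
      energy_scale γ (by positivity) hlpos (sq_nonneg _) (sq_nonneg _) (sq_nonneg _)]
    have h1 : (c ^ 2) ^ (m + 1) = c ^ p := by
      rw [← sq_rpow_half hcpos.le p]
      congr 1
      rw [hp]
      ring
    rw [h1]
    change _ * En m γ h / _ = _
    exact mul_div_mul_left _ _ (by positivity)

theorem Pop_ne_zero {h : L2} (hh : h ≠ 0) : Pop h ≠ 0 := by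
  intro h0
  apply hh
  have h1 : mulOp memLp_symP h = 0 := by
    rw [← fourier_Pop, h0]
    exact (Lp.fourierTransformₗᵢ ℝ ℂ).map_zero
  rw [Lp.eq_zero_iff_ae_eq_zero]
  have h2 := coeFn_mulOp memLp_symP h
  rw [h1] at h2
  filter_upwards [h2, Lp.coeFn_zero ℂ 2 (volume : Measure ℝ)] with ξ h3 h4
  have h6 : symP ξ * h ξ = 0 := by rw [← h3, h4]; rfl
  refine (mul_eq_zero.mp h6).resolve_left (norm_pos_iff.mp ?_)
  rw [norm_symP]
  exact wt_pos ξ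

/-- `H¹₊` contains a nonzero function. -/
theorem H1plus_diff_zero_nonempty : (H1plus \ {0}).Nonempty := by
  have hfin : volume (Set.Icc (0 : ℝ) 1) ≠ ∞ := by simp
  set h : L2 := indicatorConstLp 2 measurableSet_Icc hfin (1 : ℂ) with hh
  refine ⟨Pop h, (Pop_mem_H1plus_iff h).mpr ?_, Pop_ne_zero ?_⟩
  · filter_upwards [indicatorConstLp_coeFn (p := 2) (hs := measurableSet_Icc) (hμs := hfin)
      (c := (1 : ℂ))] with ξ h1 hξ
    rw [hh, h1, Set.indicator_of_notMem fun h2 => absurd h2.1 (not_le.mpr hξ)]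
  · rw [← norm_pos_iff, hh, norm_indicatorConstLp (by norm_num) (by norm_num)]
    simp

theorem exists_Pop_eq_of_mem_H1plus {f : L2} (hf : f ∈ H1plus) :
    ∃ h : L2, f = Pop h ∧ ∀ᵐ ξ : ℝ, ξ < 0 → h ξ = 0 := by
  obtain ⟨h, rfl⟩ := exists_Pop_eq hf.1
  exact ⟨h, rfl, (Pop_mem_H1plus_iff h).mp hf⟩

theorem Lam_eq_one {p : ℝ} (hp : 2 ≤ p) {h : L2} (hh : lpNorm p (Pop h) = 1) : Lam p h = 1 := by
  rw [← lpNorm_Pop_rpow hp, hh, Real.one_rpow]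

theorem exists_limit_of_tendsto_J {m γ : ℝ} (hm : 2 ≤ m) (hγ : 0 ≤ γ) {f : ℕ → L2}
    (hf : ∀ n, f n ∈ H1plus) (h1 : ∀ n, ‖f n‖ = 1) (h2 : ∀ n, lpNorm (2 * m + 2) (f n) = 1)
    (hlim : Tendsto (fun n => I m γ (f n)) atTop (𝓝 (J m γ))) :
    ∃ U ∈ GNorm m γ 1 1, ∃ ψ : ℕ → ℕ, StrictMono ψ ∧ ∃ x : ℕ → ℝ,
      Tendsto (fun n => h1Norm (f (ψ n) - translate (x n) U)) atTop (𝓝 0) := by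
  have hp : 2 ≤ 2 * m + 2 := by linarith
  choose h hfh hs using fun n => exists_Pop_eq_of_mem_H1plus (hf n)
  obtain rfl : f = fun n => Pop (h n) := funext hfh
  have hL (n : ℕ) : Lam (2 * m + 2) (h n) = 1 := Lam_eq_one hp (h2 n)
  have hlim' : Tendsto (fun n => En m γ (h n)) atTop (𝓝 (J m γ)) := by
    refine hlim.congr fun n => ?_
    rw [I_Pop hm, hL, div_one]
  obtain ⟨h₀, hs₀, hP₀, hL₀, hE₀, ψ, hψ, x, hx1, hx2⟩ :=
    exists_limit_of_minimizing hm hγ hs h1 hL hlim'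
  refine ⟨Pop h₀, ⟨⟨⟨(Pop_mem_H1plus_iff h₀).mpr hs₀, ?_⟩, ?_⟩, hP₀, ?_⟩, ψ, hψ, x, ?_⟩
  · rintro h3
    rw [Set.mem_singleton_iff] at h3
    rw [h3, norm_zero] at hP₀
    exact zero_ne_one hP₀
  · rw [I_Pop hm, hL₀, hE₀, div_one]
  · rw [lpNorm_Pop hp, hL₀, Real.one_rpow]
  · have h3 (n : ℕ) : h1Norm (Pop (h (ψ n)) - translate (x n) (Pop h₀)) =
        √(‖Pop (Tr (x n) (h (ψ n)) - h₀)‖ ^ 2 + ‖Qop (Tr (x n) (h (ψ n)) - h₀)‖ ^ 2) := by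
      have h4 : Pop (h (ψ n)) - translate (x n) (Pop h₀) =
          Pop (Tr (-x n) (Tr (x n) (h (ψ n)) - h₀)) := by
        rw [map_sub (Tr (-x n)), Tr_neg_Tr, map_sub, Pop_Tr_neg]
      rw [h4, h1Norm, dx_Pop, norm_Pop_Tr, norm_Qop_Tr]
    simp_rw [h3]
    simpa using (hx1.add hx2).sqrt

theorem GNorm_one_one_nonempty {m γ : ℝ} (hm : 2 ≤ m) (hγ : 0 ≤ γ) : (GNorm m γ 1 1).Nonempty := by
  obtain ⟨u, -, hu, huI⟩ := exists_seq_tendsto_sInf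
    (H1plus_diff_zero_nonempty.image (I m γ)) (bddBelow_I m hγ)
  choose g hg hgu using huI
  have hnorm (n : ℕ) : ∃ k ∈ H1plus, ‖k‖ = 1 ∧ lpNorm (2 * m + 2) k = 1 ∧ I m γ k = u n := by
    obtain ⟨h, hgh, hs⟩ := exists_Pop_eq_of_mem_H1plus (hg n).1
    have h0 : Pop h ≠ 0 := hgh ▸ (hg n).2
    obtain ⟨k, hks, hk1, hk2, hk3⟩ := exists_normalized (γ := γ) hm one_pos one_pos hs h0
    exact ⟨Pop k, (Pop_mem_H1plus_iff k).mpr hks, hk1, hk2, by rw [hk3, ← hgh, hgu]⟩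
  choose k hk hk1 hk2 hk3 using hnorm
  obtain ⟨U, hU, -⟩ := exists_limit_of_tendsto_J hm hγ hk hk1 hk2 (by simp_rw [hk3]; exact hu)
  exact ⟨U, hU⟩

theorem GNorm_nonempty {m γ a b : ℝ} (hm : 2 ≤ m) (hγ : 0 ≤ γ) (ha : 0 < a) (hb : 0 < b) :
    (GNorm m γ a b).Nonempty := by
  obtain ⟨U, ⟨⟨hU, hU0⟩, hUJ⟩, -, -⟩ := GNorm_one_one_nonempty hm hγ
  obtain ⟨h, rfl, hs⟩ := exists_Pop_eq_of_mem_H1plus hU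
  obtain ⟨k, hks, hk1, hk2, hk3⟩ := exists_normalized (γ := γ) hm ha hb hs hU0
  refine ⟨Pop k, ⟨⟨(Pop_mem_H1plus_iff k).mpr hks, ?_⟩, hk3.trans hUJ⟩, hk1, hk2⟩
  rintro h3
  rw [Set.mem_singleton_iff] at h3
  rw [h3, norm_zero] at hk1
  exact ha.ne hk1

end

end NLSSzego

theorem mainTheorem5 (m γ : ℝ) (hm : 2 ≤ m) (hγ : 0 ≤ γ) :
    (∀ f : ℕ → NLSSzego.L2,
      (∀ n, f n ∈ NLSSzego.H1plus) →
      (∀ n, ‖f n‖ = 1) →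
      (∀ n, NLSSzego.lpNorm (2 * m + 2) (f n) = 1) →
      Tendsto (fun n => NLSSzego.I m γ (f n)) atTop (𝓝 (NLSSzego.J m γ)) →
      ∃ U ∈ NLSSzego.GNorm m γ 1 1, ∃ ψ : ℕ → ℕ, StrictMono ψ ∧ ∃ x : ℕ → ℝ,
        Tendsto (fun n => NLSSzego.h1Norm (f (ψ n) - NLSSzego.translate (x n) U))
          atTop (𝓝 0)) ∧
    (∀ a b : ℝ, 0 < a → 0 < b → (NLSSzego.GNorm m γ a b).Nonempty) := by
  exact ⟨fun _ hf h1 h2 hlim => NLSSzego.exists_limit_of_tendsto_J hm hγ hf h1 h2 hlim,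
    fun _ _ ha hb => NLSSzego.GNorm_nonempty hm hγ ha hb⟩
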